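/- Let $c_0=\int_{\mathbb R}(1+\tau^2)^{-5/4}\,d\tau$ and $G(t)=\int_0^t(1+\tau^2)^{-5/4}\,d\tau$ for $t\in\mathbb R$, with $G(\infty)=\int_0^\infty(1+\tau^2)^{-5/4}\,d\tau=c_0/2$. For $u\in H^2_0(0,1)$ (identified with its continuous representative on $[0,1]$) put $$W(u)=\int_0^1\frac{u''(x)^2}{(1+u'(x)^2)^{5/2}}\,dx .$$ Let condition (A) on $\psi$ mean: $\psi\in C^0([0,1])$; $\psi(x)=\psi(1-x)$ for all $x\in(0,1)$; there is $\sigma>0$ with $\psi<0$ on $[0,\sigma)\cup(1-\sigma,1]$; and $\psi(x_0)>0$ for some $x_0\in(0,1)$. For such $\psi$ let $$\mathcal M(\psi)=\{u\in H^2_0(0,1) : u(x)=u(1-x)\text{ and }u(x)\ge\psi(x)\text{ for all }x\in(0,1)\}.$$ **Theorem 1.2.** The function $y\mapsto \dfrac{2+2(1+y^2)^{-1/4}}{c_0-G(y)}$ attains a maximum $m$ on $[0,\infty]$ (its value at $y=\infty$ being $\frac{2}{c_0-G(\infty)}$), and $\frac m2\approx1.189046454$, with error less than $5\cdot10^{-10}$.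 If $\psi$ satisfies (A) and $W$ has a minimiser in $\mathcal M(\psi)$, then $$\psi(x)\le\frac12\max_{y\in[0,\infty]}\frac{2+2(1+y^2)^{-1/4}}{c_0-G(y)}=\frac m2\qquad\text{for all }x\in[0,1].$$ Consequently, if $\psi$ satisfies (A) and $\psi(x)>\frac m2$ for some $x\in[0,1]$, then $W$ has no minimiser in $\mathcal M(\psi)$. -/

import Mathlib

open MeasureTheory Set Filter Topology
open scoped ENNReal ContDiff

noncomputable section

namespace WillmoreObstacle

/-- Lebesgue measure on the open unit interval `(0,1)`. -/
def vol01 : Measure ℝ := volume.restrict (Ioo 0 1)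

/-- `φ ∈ C_c^∞(0,1)`. -/
structure IsTestFunction (φ : ℝ → ℝ) : Prop where
  smooth : ContDiff ℝ ∞ φ
  compact : HasCompactSupport φ
  support : tsupport φ ⊆ Ioo 0 1

/-- `v` is a weak (distributional) derivative of `u` on `(0,1)`; both are locally integrable there. -/
structure IsWeakDeriv (u v : ℝ → ℝ) : Prop where
  locInt : LocallyIntegrableOn u (Ioo 0 1)
  locInt_deriv : LocallyIntegrableOn v (Ioo 0 1)
  integral_eq : ∀ φ : ℝ → ℝ, IsTestFunction φ →
    ∫ x, u x * deriv φ x ∂vol01 = -∫ x, v x * φ x ∂vol01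

open Classical in
/-- The weak derivative of `u` on `(0,1)`, which is unique up to a null set
(junk value `0` if `u` has none). -/
def weakDeriv (u : ℝ → ℝ) : ℝ → ℝ :=
  if h : ∃ v, IsWeakDeriv u v then h.choose else 0

/-- `u ∈ H²(0,1)`: `u` and its weak derivatives of orders one and two exist and lie in `L²(0,1)`. -/
structure MemH2 (u : ℝ → ℝ) : Prop where
  weak₁ : IsWeakDeriv u (weakDeriv u)
  weak₂ : IsWeakDeriv (weakDeriv u) (weakDeriv (weakDeriv u))
  memLp₀ : MemLp u 2 vol01
  memLp₁ : MemLp (weakDeriv u) 2 vol01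
  memLp₂ : MemLp (weakDeriv (weakDeriv u)) 2 vol01

/-- `u ∈ H²₀(0,1)`: `u` lies in the closure of `C_c^∞(0,1)` in `H²(0,1)`. As usual `u` stands for
its representative that is continuous on `[0,1]`, so that its point values make sense. The values
of `u` outside `[0,1]` play no role. -/
structure MemH20 (u : ℝ → ℝ) : Prop where
  cont : ContinuousOn u (Icc 0 1)
  memH2 : MemH2 u
  approx : ∀ ε : ℝ≥0∞, 0 < ε → ∃ φ : ℝ → ℝ, IsTestFunction φ ∧
    eLpNorm (u - φ) 2 vol01 < ε ∧
    eLpNorm (weakDeriv u - deriv φ) 2 vol01 < ε ∧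
    eLpNorm (weakDeriv (weakDeriv u) - deriv (deriv φ)) 2 vol01 < ε

/-- The one-dimensional Willmore (elastica) functional
`W(u) = ∫₀¹ u''² / (1 + u'²)^{5/2} dx`. -/
def W (u : ℝ → ℝ) : ℝ :=
  ∫ x, (weakDeriv (weakDeriv u) x) ^ 2 / (1 + (weakDeriv u x) ^ 2) ^ (5 / 2 : ℝ) ∂vol01

/-- Condition (A) on the obstacle `ψ : [0,1] → ℝ`: continuity, symmetry about `1/2`, negativity
near both end points, positivity somewhere. The values of `ψ` outside `[0,1]` play no role. -/
structure IsObstacle (ψ : ℝ → ℝ) : Prop where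
  cont : ContinuousOn ψ (Icc 0 1)
  symm : ∀ x ∈ Ioo (0 : ℝ) 1, ψ x = ψ (1 - x)
  neg : ∃ σ : ℝ, 0 < σ ∧ ∀ x ∈ Icc (0 : ℝ) 1, (x < σ ∨ 1 - σ < x) → ψ x < 0
  pos : ∃ x ∈ Ioo (0 : ℝ) 1, 0 < ψ x

/-- The admissible class `𝓜(ψ)`: symmetric functions in `H²₀(0,1)` lying above the obstacle. -/
def admissible (ψ : ℝ → ℝ) : Set (ℝ → ℝ) :=
  {u | MemH20 u ∧ ∀ x ∈ Ioo (0 : ℝ) 1, u x = u (1 - x) ∧ ψ x ≤ u x}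

/-- `u` is a minimiser of `W` in `𝓜(ψ)`. -/
def IsMinimiser (ψ u : ℝ → ℝ) : Prop :=
  u ∈ admissible ψ ∧ ∀ v ∈ admissible ψ, W u ≤ W v

/-- `c₀ = ∫_ℝ (1 + τ²)^{-5/4} dτ`. -/
def c₀ : ℝ := ∫ τ : ℝ, 1 / (1 + τ ^ 2) ^ (5 / 4 : ℝ)

/-- `G(t) = ∫₀ᵗ (1 + τ²)^{-5/4} dτ`. -/
def G (t : ℝ) : ℝ := ∫ τ in (0 : ℝ)..t, 1 / (1 + τ ^ 2) ^ (5 / 4 : ℝ)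

/-- `y ↦ (2 + 2 (1 + y²)^{-1/4}) / (c₀ - G(y))` on `[0,∞]`. At `y = ∞` one has
`(1 + y²)^{-1/4} = 0` and `G(∞) = ∫₀^∞ (1 + τ²)^{-5/4} dτ`. -/
def slopeBound (y : ℝ≥0∞) : ℝ :=
  if y = ⊤ then 2 / (c₀ - ∫ τ in Ioi (0 : ℝ), 1 / (1 + τ ^ 2) ^ (5 / 4 : ℝ))
  else (2 + 2 * (1 + y.toReal ^ 2) ^ (-(1 / 4) : ℝ)) / (c₀ - G y.toReal)

end WillmoreObstacle

end

open WillmoreObstacle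

/-! Write w for `weight`, q for `quartRoot` (so w = q⁵ and q'(t) = -t w(t)/2), and let p be the
slope of a minimiser u.

Euler–Lagrange. Adding a symmetric nonnegative bump keeps u admissible, and the first variation then
says that `multiplier u` has nonnegative second distributional derivative. It therefore agrees
almost everywhere with a convex function C, symmetric about 1/2. Consequently p is C¹ on (0,1), and
κ = w(p) p' = (G ∘ p)' has right derivative -ν/w(p) with ν = -C'₊/2, which is nonnegative and
nonincreasing on the left half (`exists_elasticaSystem`). For constant ν = k/2, a free elastica, κ²
+ k p is conserved.

Height. The maximum of u is u(1/2) = ∫₀^{1/2} p, so the claim is ∫₀^{1/2} (p - m) ≤ 0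
(`ElasticaSystem.integral_le`). Suppose that P = max p exceeds m; let p cross m upwards at xr, reach
P at x₀ and cross m downwards at xf. Choose k with κ(xf)² = k(P - m). Monotonicity of ν forces
2ν(x₀) ≥ k ≥ 2ν(xf), hence κ² ≥ k(P - p) on (0, xf] and κ² ≤ k(P - p) on [xf, 1/2]: the slope passes
quickly above m and falls slowly below it. The function 2q + mG has derivative (m - y) w(y), so it
measures such passages. With s = √(kP), the climb and the fall above m each contribute at most 2q(m)
+ mG(m) - m·Ginf to s∫(p - m), the last descent contributes at most 2 - 2q(m) - mG(m), and [0, xr]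
contributes nothing positive. The total is `slopeGap m`, and m is its zero. Since 2q + mG is largest
at m, this m is also the maximum of `slopeBound`.

Numerics. The substitution t = q(τ) turns G into lemniscatic integrals. An involution keeps their
arguments below 0.65, where ten Taylor terms suffice. -/

namespace WillmoreObstacle

/-! ### The weight, its primitive and the quartic root -/

/-- The weight `(1 + t²)^{-5/4}`. -/
noncomputable def weight (t : ℝ) : ℝ := 1 / (1 + t ^ 2) ^ (5 / 4 : ℝ)

/-- `G(∞)`. -/
noncomputable def Ginf : ℝ := ∫ τ in Ioi (0 : ℝ), weight τ

/-- `(1 + y²)^{-1/4}`. -/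
noncomputable def quartRoot (y : ℝ) : ℝ := (1 + y ^ 2) ^ (-(1 / 4) : ℝ)

lemma one_add_sq_pos (t : ℝ) : 0 < 1 + t ^ 2 := by positivity

lemma weight_pos (t : ℝ) : 0 < weight t := by
  have := one_add_sq_pos t
  unfold weight; positivity

lemma quartRoot_pos (t : ℝ) : 0 < quartRoot t := Real.rpow_pos_of_pos (one_add_sq_pos t) _

lemma quartRoot_pow_four (t : ℝ) : quartRoot t ^ 4 = (1 + t ^ 2)⁻¹ := by
  have h := (one_add_sq_pos t).le
  rw [quartRoot, ← Real.rpow_natCast, ← Real.rpow_mul h, ← Real.rpow_neg_one]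
  norm_num

lemma quartRoot_le_one (t : ℝ) : quartRoot t ≤ 1 :=
  Real.rpow_le_one_of_one_le_of_nonpos (by nlinarith [sq_nonneg t]) (by norm_num)

lemma weight_eq_quartRoot_pow (t : ℝ) : weight t = quartRoot t ^ 5 := by
  have h := (one_add_sq_pos t).le
  rw [quartRoot, weight, ← Real.rpow_mul_natCast h, one_div, ← Real.rpow_neg h]
  norm_num

lemma continuous_weight : Continuous weight := by
  unfold weight
  refine continuous_const.div ((by fun_prop : Continuous fun t : ℝ => 1 + t ^ 2).rpow_const
    fun t => Or.inl (one_add_sq_pos t).ne') fun t => ?_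
  exact (Real.rpow_pos_of_pos (one_add_sq_pos t) _).ne'

lemma weight_le (t : ℝ) : weight t ≤ (1 + t ^ 2)⁻¹ := by
  rw [weight_eq_quartRoot_pow, ← quartRoot_pow_four, pow_succ]
  exact mul_le_of_le_one_right (pow_nonneg (quartRoot_pos t).le 4) (quartRoot_le_one t)

lemma integrable_weight : Integrable weight := by
  refine integrable_inv_one_add_sq.mono' continuous_weight.aestronglyMeasurable
    (Eventually.of_forall fun t => ?_)
  rw [Real.norm_of_nonneg (weight_pos t).le]
  exact weight_le t

lemma c₀_eq : c₀ = 2 * Ginf := by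
  rw [Ginf, ← integral_comp_abs]
  simp only [weight, sq_abs, c₀]

lemma G_zero : G 0 = 0 := by simp [G]

lemma hasDerivAt_G (t : ℝ) : HasDerivAt G (weight t) t :=
  intervalIntegral.integral_hasDerivAt_right (continuous_weight.intervalIntegrable _ _)
    (continuous_weight.stronglyMeasurableAtFilter _ _) continuous_weight.continuousAt

lemma strictMono_G : StrictMono G :=
  strictMono_of_deriv_pos fun t => by rw [(hasDerivAt_G t).deriv]; exact weight_pos t

lemma tendsto_G : Tendsto G atTop (𝓝 Ginf) :=
  intervalIntegral_tendsto_integral_Ioi 0 integrable_weight.integrableOn tendsto_id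

lemma G_lt_Ginf (t : ℝ) : G t < Ginf :=
  (strictMono_G (lt_add_one t)).trans_le (strictMono_G.monotone.ge_of_tendsto tendsto_G _)

lemma Ginf_pos : 0 < Ginf := G_zero ▸ G_lt_Ginf 0

lemma hasDerivAt_quartRoot (t : ℝ) : HasDerivAt quartRoot (-(t * weight t) / 2) t := by
  have h1 : HasDerivAt (fun t : ℝ => 1 + t ^ 2) (2 * t) t := by
    simpa using (hasDerivAt_pow 2 t).const_add 1
  have h := h1.rpow_const (p := (-(1 / 4) : ℝ)) (Or.inl (one_add_sq_pos t).ne')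
  refine h.congr_deriv ?_
  rw [weight, one_div ((1 + t ^ 2) ^ (5 / 4 : ℝ)), ← Real.rpow_neg (one_add_sq_pos t).le]
  norm_num
  ring

lemma tendsto_quartRoot : Tendsto quartRoot atTop (𝓝 0) := by
  have h : Tendsto (fun t : ℝ => 1 + t ^ 2) atTop atTop :=
    tendsto_atTop_add_const_left _ _ (tendsto_pow_atTop two_ne_zero)
  exact (tendsto_rpow_neg_atTop (by norm_num : (0 : ℝ) < 1 / 4)).comp h

/-! ### Lemniscatic integrals and their Taylor enclosures -/

/-- The lemniscatic integral of the second kind. -/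
noncomputable def lemni (x : ℝ) : ℝ := ∫ t in (0 : ℝ)..x, t ^ 2 / √(1 - t ^ 4)

lemma one_sub_pow_four_pos {t : ℝ} (h0 : 0 ≤ t) (h1 : t < 1) : 0 < 1 - t ^ 4 := by
  have := pow_lt_one₀ h0 h1 (n := 4) (by norm_num)
  linarith

lemma continuousOn_lemni_integrand :
    ContinuousOn (fun t : ℝ => t ^ 2 / √(1 - t ^ 4)) (Ioo (-1) 1) := by
  refine ContinuousOn.div (by fun_prop) (by fun_prop) fun t ht => ?_
  have : 0 < 1 - |t| ^ 4 := one_sub_pow_four_pos (abs_nonneg t) (abs_lt.2 ht)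
  rw [show |t| ^ 4 = t ^ 4 from by rw [← abs_pow, abs_of_nonneg (by positivity)]] at this
  exact (Real.sqrt_pos.2 this).ne'

lemma hasDerivAt_lemni {x : ℝ} (h0 : 0 ≤ x) (h1 : x < 1) :
    HasDerivAt lemni (x ^ 2 / √(1 - x ^ 4)) x := by
  have hx : x ∈ Ioo (-1 : ℝ) 1 := ⟨by linarith, h1⟩
  refine intervalIntegral.integral_hasDerivAt_right ?_ ?_
    (continuousOn_lemni_integrand.continuousAt (isOpen_Ioo.mem_nhds hx))
  · refine (continuousOn_lemni_integrand.mono ?_).intervalIntegrable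
    rw [uIcc_of_le h0]
    exact fun t ht => ⟨by linarith [ht.1], ht.2.trans_lt h1⟩
  · exact continuousOn_lemni_integrand.stronglyMeasurableAtFilter isOpen_Ioo _ hx

lemma lemni_zero : lemni 0 = 0 := by simp [lemni]

lemma quartRoot_lt_one {t : ℝ} (ht : 0 < t) : quartRoot t < 1 :=
  Real.rpow_lt_one_of_one_lt_of_neg (by nlinarith [sq_pos_of_pos ht]) (by norm_num)

lemma sqrt_one_sub_quartRoot {t : ℝ} (ht : 0 ≤ t) :
    √(1 - quartRoot t ^ 4) = t * quartRoot t ^ 2 := by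
  have h := one_add_sq_pos t
  have h4 : quartRoot t ^ 4 * (1 + t ^ 2) = 1 := by
    rw [quartRoot_pow_four, inv_mul_cancel₀ h.ne']
  rw [show 1 - quartRoot t ^ 4 = (t * quartRoot t ^ 2) ^ 2 by linear_combination -h4]
  exact Real.sqrt_sq (by positivity)

/-- `∫_y^∞ (1 + τ²)^{-5/4} dτ` as a lemniscatic integral. -/
lemma Ginf_sub_G {y : ℝ} (hy : 0 < y) : Ginf - G y = 2 * lemni (quartRoot y) := by
  have hd : ∀ t, 0 < t → HasDerivAt (fun t => G t + 2 * lemni (quartRoot t)) 0 t := by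
    intro t ht
    have h := (hasDerivAt_G t).add (((hasDerivAt_lemni (quartRoot_pos t).le
      (quartRoot_lt_one ht)).comp t (hasDerivAt_quartRoot t)).const_mul 2)
    refine h.congr_deriv ?_
    rw [sqrt_one_sub_quartRoot ht.le]
    have := (quartRoot_pos t).ne'
    field_simp
    ring
  have hconst : ∀ b, y ≤ b → G b + 2 * lemni (quartRoot b) = G y + 2 * lemni (quartRoot y) := by
    intro b hb
    refine constant_of_has_deriv_right_zero (a := y) (b := b) 
      (f := fun t => G t + 2 * lemni (quartRoot t))
      (fun t ht => (hd t (hy.trans_le ht.1)).continuousAt.continuousWithinAt)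
      (fun t ht => (hd t (hy.trans_le ht.1)).hasDerivWithinAt) b ⟨hb, le_rfl⟩
  have hl : Tendsto (fun t => G t + 2 * lemni (quartRoot t)) atTop (𝓝 (Ginf + 2 * lemni 0)) :=
    tendsto_G.add (((hasDerivAt_lemni le_rfl one_pos).continuousAt.tendsto.comp
      tendsto_quartRoot).const_mul 2)
  have := tendsto_nhds_unique_of_eventuallyEq hl tendsto_const_nhds
    (eventually_atTop.2 ⟨y, fun b hb => hconst b hb⟩)
  rw [lemni_zero] at this
  linarith

/-- The involution formula for the lemniscatic integral. -/
lemma G_eq_lemni {x : ℝ} (h0 : 0 ≤ x) (h1 : x < 1) :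
    G (2 * x / (1 - x ^ 2)) = 2 * x * √((1 - x ^ 2) / (1 + x ^ 2)) + 2 * lemni x := by
  -- Both sides vanish at 0, so equality of derivatives is enough. With A = √(1 - t²) and B = √(1 +
  -- t²) everything becomes rational, since `quartRoot` at 2t/(1 - t²) equals A/B.
  have hd : ∀ t, 0 ≤ t → t < 1 → HasDerivAt (fun t => G (2 * t / (1 - t ^ 2)) -
      2 * t * √((1 - t ^ 2) / (1 + t ^ 2)) - 2 * lemni t) 0 t := by
    intro t ht0 ht1
    have ha : 0 < 1 - t ^ 2 := by nlinarith
    have hb := one_add_sq_pos t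
    have hb' : HasDerivAt (fun t : ℝ => 1 + t ^ 2) (2 * t) t := by
      simpa using (hasDerivAt_pow 2 t).const_add 1
    have ha' : HasDerivAt (fun t : ℝ => 1 - t ^ 2) (-(2 * t)) t := by
      simpa using (hasDerivAt_pow 2 t).const_sub 1
    have hid : HasDerivAt (fun t : ℝ => 2 * t) 2 t := by simpa using (hasDerivAt_id t).const_mul 2
    have hz := (hasDerivAt_G (2 * t / (1 - t ^ 2))).comp t (hid.div ha' ha.ne')
    have hR := (ha'.div hb' hb.ne').sqrt (div_pos ha hb).ne'
    have h := (hz.sub (hid.mul hR)).sub ((hasDerivAt_lemni ht0 ht1).const_mul 2)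
    refine h.congr_deriv ?_
    have hsa := Real.sq_sqrt ha.le
    have hsb := Real.sq_sqrt hb.le
    have ha2 := Real.sqrt_pos.2 ha
    have hb2 := Real.sqrt_pos.2 hb
    have p4 : ∀ a : ℝ, a ^ 4 = (a ^ 2) ^ 2 := fun a => by ring
    have hAB : √((1 - t ^ 2) / (1 + t ^ 2)) = √(1 - t ^ 2) / √(1 + t ^ 2) := Real.sqrt_div ha.le _
    have hAB' : √(1 - t ^ 4) = √(1 - t ^ 2) * √(1 + t ^ 2) := by
      rw [← Real.sqrt_mul ha.le]; ring_nf
    have hw : weight (2 * t / (1 - t ^ 2)) = (√(1 - t ^ 2) / √(1 + t ^ 2)) ^ 5 := by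
      have : quartRoot (2 * t / (1 - t ^ 2)) = √(1 - t ^ 2) / √(1 + t ^ 2) := by
        refine (pow_left_inj₀ (quartRoot_pos _).le (by positivity) (by norm_num : 4 ≠ 0)).1 ?_
        rw [quartRoot_pow_four, div_pow √(1 - t ^ 2), p4 √(1 - t ^ 2), p4 √(1 + t ^ 2), hsa, hsb]
        field_simp
        ring
      rw [weight_eq_quartRoot_pow, this]
    simp only [Pi.div_apply]
    rw [hw, hAB, hAB']
    have e1 : (2 * (1 - t ^ 2) - 2 * t * -(2 * t)) / (1 - t ^ 2) ^ 2 =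
        2 * √(1 + t ^ 2) ^ 2 / √(1 - t ^ 2) ^ 4 := by
      rw [p4 √(1 - t ^ 2), hsa, hsb]; ring
    have e2 : (-(2 * t) * (1 + t ^ 2) - (1 - t ^ 2) * (2 * t)) / (1 + t ^ 2) ^ 2 =
        -(4 * t) / √(1 + t ^ 2) ^ 4 := by
      rw [p4 √(1 + t ^ 2), hsb]; ring
    rw [e1, e2]
    generalize √(1 - t ^ 2) = A at *
    generalize √(1 + t ^ 2) = B at *
    have key : A ^ 2 - A ^ 2 * B ^ 2 + 2 * t ^ 2 - t ^ 2 * B ^ 2 = 0 := by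
      rw [hsa, hsb]; ring
    have : (A / B) ^ 5 * (2 * B ^ 2 / A ^ 4) - (2 * (A / B) + 2 * t * (-(4 * t) / B ^ 4 /
        (2 * (A / B)))) - 2 * (t ^ 2 / (A * B)) =
        2 * (A ^ 2 - A ^ 2 * B ^ 2 + 2 * t ^ 2 - t ^ 2 * B ^ 2) / (A * B ^ 3) := by
      field_simp
      ring
    rw [this, key]
    simp
  have := constant_of_has_deriv_right_zero (a := 0) (b := x)
    (fun t ht => (hd t ht.1 (ht.2.trans_lt h1)).continuousAt.continuousWithinAt)
    (fun t ht => (hd t ht.1 (ht.2.trans h1)).hasDerivWithinAt) x ⟨h0, le_rfl⟩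
  simp [lemni_zero, G_zero] at this
  linarith

/-- The Taylor polynomial of order nine of `(1 - s)^{-1/2}`. -/
noncomputable def invSqrtTaylor (s : ℝ) : ℝ :=
  1 + s / 2 + 3 * s ^ 2 / 8 + 5 * s ^ 3 / 16 + 35 * s ^ 4 / 128 + 63 * s ^ 5 / 256 +
    231 * s ^ 6 / 1024 + 429 * s ^ 7 / 2048 + 6435 * s ^ 8 / 32768 + 12155 * s ^ 9 / 65536

/-- Squaring removes the root: 1 - T(s)²(1 - s) is s¹⁰ times a polynomial with positive
coefficients. -/
lemma invSqrtTaylor_le {s : ℝ} (h0 : 0 ≤ s) (h1 : s < 1) : invSqrtTaylor s ≤ 1 / √(1 - s) := by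
  have hs : 0 < 1 - s := by linarith
  rw [le_div_iff₀ (Real.sqrt_pos.2 hs)]
  have hq : 0 ≤ invSqrtTaylor s := by unfold invSqrtTaylor; positivity
  refine le_of_sq_le_sq ?_ zero_le_one
  rw [mul_pow, Real.sq_sqrt hs.le]
  have : 1 - invSqrtTaylor s ^ 2 * (1 - s) = s ^ 10 * (46189 / 131072 + 20995 / 131072 * s +
      230945 / 2097152 * s ^ 2 + 88825 / 1048576 * s ^ 3 + 1154725 / 16777216 * s ^ 4 +
      969969 / 16777216 * s ^ 5 + 53348295 / 1073741824 * s ^ 6 + 5827965 / 134217728 * s ^ 7 +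
      165125675 / 4294967296 * s ^ 8 + 147744025 / 4294967296 * s ^ 9) := by
    unfold invSqrtTaylor; ring
  have h : 0 ≤ 1 - invSqrtTaylor s ^ 2 * (1 - s) := by rw [this]; positivity
  linarith

/-- The next binomial coefficient, 46189/262144, is below 1/4, which leaves room for the whole tail
when s ≤ 9/50. The fourth powers used later are about 0.172 and 0.150. -/
lemma le_invSqrtTaylor_add {s : ℝ} (h0 : 0 ≤ s) (h1 : s ≤ 9 / 50) :
    1 / √(1 - s) ≤ invSqrtTaylor s + s ^ 10 / 4 := by
  have hs : 0 < 1 - s := by linarith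
  rw [div_le_iff₀ (Real.sqrt_pos.2 hs)]
  have hq : 0 ≤ invSqrtTaylor s + s ^ 10 / 4 := by unfold invSqrtTaylor; positivity
  refine le_of_sq_le_sq ?_ (by positivity)
  rw [mul_pow, Real.sq_sqrt hs.le]
  have : (invSqrtTaylor s + s ^ 10 / 4) ^ 2 * (1 - s) - 1 = s ^ 10 * (19347 / 131072 - s * (
      53763 / 131072 + 362017 / 2097152 * s + 121593 / 1048576 * s ^ 2 +
      1482405 / 16777216 * s ^ 3 + 1199345 / 16777216 * s ^ 4 + 64358343 / 1073741824 * s ^ 5 +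
      6909309 / 134217728 * s ^ 6 + 193240619 / 4294967296 * s ^ 7 +
      171173145 / 4294967296 * s ^ 8 + 3963 / 131072 * s ^ 9 + 1 / 16 * s ^ 10)) := by
    unfold invSqrtTaylor; ring
  have h2 : s * (
      53763 / 131072 + 362017 / 2097152 * s + 121593 / 1048576 * s ^ 2 +
      1482405 / 16777216 * s ^ 3 + 1199345 / 16777216 * s ^ 4 + 64358343 / 1073741824 * s ^ 5 +
      6909309 / 134217728 * s ^ 6 + 193240619 / 4294967296 * s ^ 7 +
      171173145 / 4294967296 * s ^ 8 + 3963 / 131072 * s ^ 9 + 1 / 16 * s ^ 10) ≤ (9 / 50) * (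
      53763 / 131072 + 362017 / 2097152 * (9 / 50) + 121593 / 1048576 * (9 / 50) ^ 2 +
      1482405 / 16777216 * (9 / 50) ^ 3 + 1199345 / 16777216 * (9 / 50) ^ 4 +
      64358343 / 1073741824 * (9 / 50) ^ 5 +
      6909309 / 134217728 * (9 / 50) ^ 6 + 193240619 / 4294967296 * (9 / 50) ^ 7 +
      171173145 / 4294967296 * (9 / 50) ^ 8 + 3963 / 131072 * (9 / 50) ^ 9 +
      1 / 16 * (9 / 50) ^ 10) := by
    gcongr
  have h : 0 ≤ (invSqrtTaylor s + s ^ 10 / 4) ^ 2 * (1 - s) - 1 := by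
    rw [this]
    exact mul_nonneg (by positivity) (by norm_num at h2 ⊢; linarith)
  linarith

/-- The primitive of `x² invSqrtTaylor (x⁴)`. -/
noncomputable def lemniTaylor (x : ℝ) : ℝ :=
  x ^ 3 / 3 + x ^ 7 / 14 + 3 * x ^ 11 / 88 + x ^ 15 / 48 + 35 * x ^ 19 / 2432 +
    63 * x ^ 23 / 5888 + 77 * x ^ 27 / 9216 + 429 * x ^ 31 / 63488 + 1287 * x ^ 35 / 229376 +
    935 * x ^ 39 / 196608

lemma hasDerivAt_lemniTaylor (x : ℝ) :
    HasDerivAt lemniTaylor (x ^ 2 * invSqrtTaylor (x ^ 4)) x := by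
  have h : ∀ (n : ℕ) (c d : ℝ), HasDerivAt (fun x : ℝ => c * x ^ n / d) (c * (n * x ^ (n - 1)) / d) x :=
    fun n c d => ((hasDerivAt_pow n x).const_mul c).div_const d
  have h' := (((((((((h 3 1 3).add (h 7 1 14)).add (h 11 3 88)).add (h 15 1 48)).add
    (h 19 35 2432)).add (h 23 63 5888)).add (h 27 77 9216)).add (h 31 429 63488)).add
    (h 35 1287 229376)).add (h 39 935 196608)
  refine (h'.congr_deriv ?_).congr_of_eventuallyEq (Eventually.of_forall fun y => ?_)
  · unfold invSqrtTaylor; push_cast; ring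
  · simp [lemniTaylor]

/-- Integrates the enclosure of (1 - s)^(-1/2) at s = t⁴ against t²; the error t⁴²/4 integrates to
x⁴³/172. -/
lemma lemni_bounds {x : ℝ} (h0 : 0 ≤ x) (h1 : x ^ 4 ≤ 9 / 50) :
    lemniTaylor x ≤ lemni x ∧ lemni x ≤ lemniTaylor x + x ^ 43 / 172 := by
  have hlt : ∀ t ∈ Icc 0 x, t < 1 := fun t ht => by
    by_contra! h
    have := one_le_pow₀ (h.trans ht.2) (n := 4)
    linarith
  have h4 : ∀ t ∈ Icc 0 x, t ^ 4 ≤ 9 / 50 := fun t ht =>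
    (pow_le_pow_left₀ ht.1 ht.2 4).trans h1
  have mono : ∀ f f' : ℝ → ℝ, (∀ t ∈ Icc 0 x, HasDerivAt f (f' t) t) → (∀ t ∈ Icc 0 x, 0 ≤ f' t) →
      f 0 ≤ f x := by
    intro f f' hf hf'
    refine (monotoneOn_of_deriv_nonneg (convex_Icc 0 x)
      (fun t ht => (hf t ht).continuousAt.continuousWithinAt)
      (fun t ht => (hf t (interior_subset ht)).differentiableAt.differentiableWithinAt)
      (fun t ht => ?_)) ⟨le_rfl, h0⟩ ⟨h0, le_rfl⟩ h0
    rw [(hf t (interior_subset ht)).deriv]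
    exact hf' t (interior_subset ht)
  have z : lemniTaylor 0 = 0 := by simp [lemniTaylor]
  constructor
  · have := mono _ _ (fun t ht => (hasDerivAt_lemni ht.1 (hlt t ht)).sub (hasDerivAt_lemniTaylor t))
      fun t ht => by
        have := invSqrtTaylor_le (s := t ^ 4) (by positivity)
          (sub_pos.1 (one_sub_pow_four_pos ht.1 (hlt t ht)))
        rw [← mul_one_div]
        exact sub_nonneg.2 (mul_le_mul_of_nonneg_left this (by positivity))
    simp [lemni_zero, z] at this
    linarith
  · have := mono _ _ (fun t ht => ((hasDerivAt_lemniTaylor t).add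
        ((hasDerivAt_pow 43 t).div_const 172)).sub (hasDerivAt_lemni ht.1 (hlt t ht)))
      fun t ht => by
        have := le_invSqrtTaylor_add (s := t ^ 4) (by positivity) (h4 t ht)
        have := mul_le_mul_of_nonneg_left this (sq_nonneg t)
        rw [mul_one_div] at this
        have e : ((43 : ℕ) : ℝ) * t ^ (43 - 1) / 172 = t ^ 2 * ((t ^ 4) ^ 10 / 4) := by
          push_cast; ring
        rw [e]
        linarith
    simp [lemni_zero, z] at this
    linarith

lemma lemni_mono {x y : ℝ} (h0 : 0 ≤ x) (hxy : x ≤ y) (h1 : y < 1) : lemni x ≤ lemni y := by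
  refine (monotoneOn_of_deriv_nonneg (convex_Ico 0 1)
      (fun t ht => (hasDerivAt_lemni ht.1 ht.2).continuousAt.continuousWithinAt)
      (fun t ht => (hasDerivAt_lemni (interior_subset ht).1
        (interior_subset ht).2).differentiableAt.differentiableWithinAt)
      (fun t ht => ?_)) ⟨h0, hxy.trans_lt h1⟩ ⟨h0.trans hxy, h1⟩ hxy
  rw [(hasDerivAt_lemni (interior_subset ht).1 (interior_subset ht).2).deriv]
  positivity

/-- The point r = √(√2 - 1) is fixed by x ↦ √((1 - x²)/(1 + x²)). Adding the tail formula and the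
involution formula there avoids the endpoint 1, where the lemniscatic integrand is singular. -/
lemma Ginf_eq : Ginf = 2 * (√2 - 1) + 4 * lemni √(√2 - 1) := by
  have h2 : √2 ^ 2 = 2 := Real.sq_sqrt zero_le_two
  have h1 : 1 < √2 := by rw [Real.lt_sqrt] <;> norm_num
  have h3 : √2 < 2 := by rw [Real.sqrt_lt'] <;> norm_num
  set r := √(√2 - 1) with hr
  have hr2 : r ^ 2 = √2 - 1 := Real.sq_sqrt (by linarith)
  have hr0 : 0 < r := Real.sqrt_pos.2 (by linarith)
  have hr1 : r < 1 := by nlinarith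
  have hr4 : r ^ 4 = 1 - 2 * r ^ 2 := by
    rw [show r ^ 4 = (r ^ 2) ^ 2 by ring, hr2]; linear_combination h2
  have ha : 0 < 1 - r ^ 2 := by nlinarith
  have hz : 0 < 2 * r / (1 - r ^ 2) := by positivity
  have hq : quartRoot (2 * r / (1 - r ^ 2)) = r := by
    refine (pow_left_inj₀ (quartRoot_pos _).le hr0.le (by norm_num : 4 ≠ 0)).1 ?_
    rw [quartRoot_pow_four]
    field_simp
    linear_combination (-r ^ 4 -  1) * hr4
  have hs : √((1 - r ^ 2) / (1 + r ^ 2)) = r := by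
    rw [Real.sqrt_eq_iff_mul_self_eq (by positivity) hr0.le]
    field_simp
    linear_combination -hr4
  have e1 := Ginf_sub_G hz
  have e2 := G_eq_lemni hr0.le hr1
  rw [hq] at e1
  rw [hs] at e2
  linear_combination e1 + e2 + 2 * hr2

/-! ### The maximum of `slopeBound` and its numerical value -/

/-- Numerator minus `y` times denominator of `slopeBound`; its zero is the maximum of
`slopeBound`. -/
noncomputable def slopeGap (y : ℝ) : ℝ := 2 + 2 * quartRoot y - y * (2 * Ginf - G y)

lemma hasDerivAt_slopeGap (y : ℝ) : HasDerivAt slopeGap (-(2 * Ginf - G y)) y := by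
  have h := (((hasDerivAt_quartRoot y).const_mul 2).const_add 2).sub
    ((hasDerivAt_id y).mul ((hasDerivAt_G y).const_sub (2 * Ginf)))
  exact h.congr_deriv (by simp; ring)

lemma slopeGap_eq {y : ℝ} (hy : 0 < y) :
    slopeGap y = 2 + 2 * quartRoot y - y * (Ginf + 2 * lemni (quartRoot y)) := by
  rw [slopeGap, ← Ginf_sub_G hy]; ring

lemma Ginf_bounds : 1.1981402346 ≤ Ginf ∧ Ginf ≤ 1.19814023477 := by
  have h1 : (1.414213562373 : ℝ) ≤ √2 := Real.le_sqrt_of_sq_le (by norm_num)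
  have h2 : √2 ≤ 1.4142135623731 := (Real.sqrt_le_left (by norm_num)).2 (by norm_num)
  have h3 : (0.643594252905 : ℝ) ≤ √(√2 - 1) :=
    Real.le_sqrt_of_sq_le (le_trans (by norm_num) (sub_le_sub_right h1 1))
  have h4 : √(√2 - 1) ≤ 0.643594252906 :=
    (Real.sqrt_le_left (by norm_num)).2 ((sub_le_sub_right h2 1).trans (by norm_num))
  have h5 := (lemni_bounds (x := 0.643594252905) (by norm_num) (by norm_num)).1.trans
    (lemni_mono (by norm_num) h3 (h4.trans_lt (by norm_num)))
  have h6 := (lemni_mono (Real.sqrt_nonneg _) h4 (by norm_num)).trans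
    (lemni_bounds (x := 0.643594252906) (by norm_num) (by norm_num)).2
  have h7 : (0.0924282774683 : ℝ) ≤ lemniTaylor 0.643594252905 := by
    norm_num [lemniTaylor]
  have h8 : lemniTaylor 0.643594252906 + 0.643594252906 ^ 43 / 172 ≤ 0.0924282775037 := by
    norm_num [lemniTaylor]
  rw [Ginf_eq]
  constructor <;> linarith

/-- This point and the one in `slopeGap_upper` are 2·10⁻⁹ apart with midpoint 2·1.189046454, so a
zero strictly between them gives exactly the required error for m/2. -/
lemma slopeGap_lower : 0 < slopeGap 2.378092907 := by
  have h := quartRoot_pow_four 2.378092907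
  have h0 := (quartRoot_pos 2.378092907).le
  rw [slopeGap_eq (by norm_num)]
  have h1 : (0.6225979246301 : ℝ) ≤ quartRoot 2.378092907 := by
    refine le_of_pow_le_pow_left₀ (n := 4) (by norm_num) h0 ?_
    rw [h]; norm_num
  have h2 : quartRoot 2.378092907 ≤ 0.6225979246302 := by
    refine le_of_pow_le_pow_left₀ (n := 4) (by norm_num) (by norm_num) ?_
    rw [h]; norm_num
  have h3 := (lemni_mono h0 h2 (by norm_num)).trans (lemni_bounds (by norm_num) (by norm_num)).2
  have h4 : lemniTaylor 0.6225979246302 + 0.6225979246302 ^ 43 / 172 ≤ 0.083240451458 := by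
    norm_num [lemniTaylor]
  have h5 := Ginf_bounds.2
  linarith

lemma slopeGap_upper : slopeGap 2.378092909 < 0 := by
  have h := quartRoot_pow_four 2.378092909
  have h0 := (quartRoot_pos 2.378092909).le
  rw [slopeGap_eq (by norm_num)]
  have h1 : (0.6225979244076 : ℝ) ≤ quartRoot 2.378092909 := by
    refine le_of_pow_le_pow_left₀ (n := 4) (by norm_num) h0 ?_
    rw [h]; norm_num
  have h2 : quartRoot 2.378092909 ≤ 0.6225979244077 := by
    refine le_of_pow_le_pow_left₀ (n := 4) (by norm_num) (by norm_num) ?_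
    rw [h]; norm_num
  have h3 := (lemni_bounds (by norm_num) (by norm_num)).1.trans
    (lemni_mono (by norm_num) h1 (h2.trans_lt (by norm_num)))
  have h4 : (0.0832404513558 : ℝ) ≤ lemniTaylor 0.6225979244076 := by
    norm_num [lemniTaylor]
  have h5 := Ginf_bounds.1
  linarith

/-- The maximum of `slopeBound` is the zero of `slopeGap`. -/
lemma exists_slopeGap_eq_zero :
    ∃ m : ℝ, 2.378092907 < m ∧ m < 2.378092909 ∧ slopeGap m = 0 := by
  have hc : ContinuousOn slopeGap (Icc 2.378092907 2.378092909) :=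
    fun y _ => (hasDerivAt_slopeGap y).continuousAt.continuousWithinAt
  obtain ⟨m, hm, hm0⟩ := intermediate_value_Ioo' (by norm_num) hc ⟨slopeGap_upper, slopeGap_lower⟩
  exact ⟨m, hm.1, hm.2, hm0⟩

lemma monotoneOn_antitoneOn_quartRoot_add_G {m : ℝ} :
    MonotoneOn (fun y => 2 * quartRoot y + m * G y) (Iic m) ∧
      AntitoneOn (fun y => 2 * quartRoot y + m * G y) (Ici m) := by
  have hd : ∀ y, HasDerivAt (fun y => 2 * quartRoot y + m * G y) ((m - y) * weight y) y := fun y =>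
    (((hasDerivAt_quartRoot y).const_mul 2).add ((hasDerivAt_G y).const_mul m)).congr_deriv (by ring)
  constructor
  · refine monotoneOn_of_deriv_nonneg (convex_Iic m)
      (fun y _ => (hd y).continuousAt.continuousWithinAt)
      (fun y _ => (hd y).differentiableAt.differentiableWithinAt) fun y hy => ?_
    rw [(hd y).deriv]
    exact mul_nonneg (sub_nonneg.2 (mem_Iic.1 (interior_subset hy))) (weight_pos y).le
  · refine antitoneOn_of_deriv_nonpos (convex_Ici m)
      (fun y _ => (hd y).continuousAt.continuousWithinAt)
      (fun y _ => (hd y).differentiableAt.differentiableWithinAt) fun y hy => ?_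
    rw [(hd y).deriv]
    exact mul_nonpos_of_nonpos_of_nonneg (sub_nonpos.2 (mem_Ici.1 (interior_subset hy))) (weight_pos y).le

lemma slopeBound_coe (y : ℝ≥0∞) (hy : y ≠ ⊤) :
    slopeBound y = (2 + 2 * quartRoot y.toReal) / (2 * Ginf - G y.toReal) := by
  rw [slopeBound, if_neg hy, c₀_eq]; rfl

lemma slopeBound_top : slopeBound ⊤ = 2 / Ginf := by
  rw [slopeBound, if_pos rfl, c₀_eq]
  change 2 / (2 * Ginf - Ginf) = _
  ring_nf

/-- Clearing the positive denominator, the quotient at y is at most m iff 2q(y) + mG(y) ≤ 2m·Ginf -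
2. The left side is largest at y = m, where `slopeGap m = 0` gives equality. -/
lemma isGreatest_slopeBound {m : ℝ} (hm0 : 0 ≤ m) (hm : slopeGap m = 0) :
    IsGreatest (range slopeBound) m := by
  have hD : ∀ y, 0 < 2 * Ginf - G y := fun y => by linarith [G_lt_Ginf y, Ginf_pos]
  have hle : ∀ y, (2 + 2 * quartRoot y) / (2 * Ginf - G y) ≤ m := by
    intro y
    rw [div_le_iff₀ (hD y)]
    have hmax : 2 * quartRoot y + m * G y ≤ 2 * quartRoot m + m * G m := by
      rcases le_total y m with h | h
      · exact monotoneOn_antitoneOn_quartRoot_add_G.1 h self_mem_Iic h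
      · exact monotoneOn_antitoneOn_quartRoot_add_G.2 self_mem_Ici h h
    rw [slopeGap] at hm
    linarith
  constructor
  · refine ⟨ENNReal.ofReal m, ?_⟩
    rw [slopeBound_coe _ ENNReal.ofReal_ne_top, ENNReal.toReal_ofReal hm0, div_eq_iff (hD m).ne']
    rw [slopeGap] at hm
    linarith
  · rintro _ ⟨y, rfl⟩
    by_cases hy : y = ⊤
    -- The value 2/Ginf at ∞ coincides with the value 4/(2·Ginf) at 0.
    · have h := hle 0
      rw [hy, slopeBound_top]
      refine le_trans (le_of_eq ?_) h
      have : quartRoot 0 = 1 := by simp [quartRoot]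
      rw [this, G_zero]
      have := Ginf_pos.ne'
      field_simp
      ring
    · rw [slopeBound_coe y hy]
      exact hle _

/-! ### Height gained or lost against the line of slope `m` -/

lemma le_of_rightDeriv_nonpos {f f' : ℝ → ℝ} {a b : ℝ} (hab : a ≤ b) (hf : ContinuousOn f (Icc a b))
    (hf' : ∀ x ∈ Ico a b, HasDerivWithinAt f (f' x) (Ici x) x) (h : ∀ x ∈ Ico a b, f' x ≤ 0) :
    f b ≤ f a :=
  image_le_of_deriv_right_le_deriv_boundary hf hf' (B := fun _ => f a) (B' := fun _ => 0) le_rfl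
    continuousOn_const (fun _ _ => hasDerivWithinAt_const _ _ _) h ⟨hab, le_rfl⟩

lemma le_of_rightDeriv_nonneg {f f' : ℝ → ℝ} {a b : ℝ} (hab : a ≤ b) (hf : ContinuousOn f (Icc a b))
    (hf' : ∀ x ∈ Ico a b, HasDerivWithinAt f (f' x) (Ici x) x) (h : ∀ x ∈ Ico a b, 0 ≤ f' x) :
    f a ≤ f b := by
  have := le_of_rightDeriv_nonpos (f := fun x => -f x) hab hf.neg (fun x hx => (hf' x hx).neg)
    fun x hx => neg_nonpos.2 (h x hx)
  linarith

lemma hasDerivAt_quartRoot_add_G (m y : ℝ) :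
    HasDerivAt (fun y => 2 * quartRoot y + m * G y) ((m - y) * weight y) y :=
  (((hasDerivAt_quartRoot y).const_mul 2).add ((hasDerivAt_G y).const_mul m)).congr_deriv (by ring)

/-- Beyond m the function 2q + mG decreases to its limit m·Ginf. -/
lemma mul_Ginf_le {m y : ℝ} (hy : m ≤ y) : m * Ginf ≤ 2 * quartRoot y + m * G y := by
  have hl : Tendsto (fun y => 2 * quartRoot y + m * G y) atTop (𝓝 (2 * 0 + m * Ginf)) :=
    (tendsto_quartRoot.const_mul 2).add (tendsto_G.const_mul m)
  rw [mul_zero, zero_add] at hl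
  refine le_of_tendsto hl (eventually_atTop.2 ⟨y, fun z hz => ?_⟩)
  exact monotoneOn_antitoneOn_quartRoot_add_G.2 hy (hy.trans hz) hz

lemma quartRoot_le_mul {p c : ℝ} (hc : 1 ≤ c) : quartRoot p ≤ quartRoot (c ^ 2 * p) * c := by
  have hc0 : 0 < c := by linarith
  refine le_of_pow_le_pow_left₀ (n := 4) (by norm_num)
    (mul_nonneg (quartRoot_pos _).le hc0.le) ?_
  rw [mul_pow, quartRoot_pow_four, quartRoot_pow_four, ← div_eq_inv_mul, inv_eq_one_div,
    div_le_div_iff₀ (one_add_sq_pos _) (one_add_sq_pos _)]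
  have : 1 ≤ c ^ 4 := one_le_pow₀ hc
  nlinarith

/-- On a branch where the slope `p` climbs from above `m` towards `P`, at least as fast as for
a free elastica, the height gained over the line of slope `m` is controlled. -/
lemma integral_sub_le_of_climb {p κ : ℝ → ℝ} {a b k P m : ℝ} (hab : a ≤ b) (hm : 0 < m)
    (hpc : Continuous p) (hp : ∀ x ∈ Icc a b, HasDerivAt p (κ x / weight (p x)) x) (hκ0 : ∀ x ∈ Icc a b, 0 ≤ κ x)
    (hκ : ∀ x ∈ Icc a b, k * (P - p x) ≤ κ x ^ 2) (hmp : ∀ x ∈ Icc a b, m ≤ p x)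
    (hpP : ∀ x ∈ Icc a b, p x < P) :
    √(k * P) * ∫ x in a..b, (p x - m) ≤ 2 * quartRoot m + m * G m - m * Ginf := by
  set s := √(k * P)
  have hP : 0 < P := hm.trans_le ((hmp a ⟨le_rfl, hab⟩).trans (hpP a ⟨le_rfl, hab⟩).le)
  -- The comparison slope z = pP/(P - p) dominates p and tends to ∞ as p → P; bounding 2q + mG at z
  -- below by its limit at ∞ produces the term m·Ginf.
  have hz : ∀ x ∈ Icc a b, p x ≤ p x * P / (P - p x) := fun x hx => by
    have h1 := hpP x hx
    have h2 := hm.trans_le (hmp x hx)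
    rw [le_div_iff₀ (sub_pos.2 h1)]
    nlinarith
  have hd : ∀ x ∈ Icc a b, HasDerivAt (fun x => s * (∫ t in a..x, (p t - m)) +
      (2 * quartRoot (p x * P / (P - p x)) + m * G (p x * P / (P - p x))))
      (s * (p x - m) + (m - p x * P / (P - p x)) * weight (p x * P / (P - p x)) *
        (κ x / weight (p x) * (P / (P - p x)) ^ 2)) x := by
    intro x hx
    have hne : P - p x ≠ 0 := (sub_pos.2 (hpP x hx)).ne'
    have h1 : HasDerivAt (fun x => ∫ t in a..x, (p t - m)) (p x - m) x :=
      ((hpc.sub continuous_const).integral_hasStrictDerivAt a x).hasDerivAt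
    have h2 : HasDerivAt (fun x => p x * P / (P - p x))
        (κ x / weight (p x) * (P / (P - p x)) ^ 2) x := by
      refine (((hp x hx).mul_const P).div ((hp x hx).const_sub P) hne).congr_deriv ?_
      field_simp
      ring
    exact (h1.const_mul s).add ((hasDerivAt_quartRoot_add_G m _).comp x h2)
  -- The function s∫(p - m) + (2q + mG)(z) is nonincreasing. With c² = P/(P - p) and z = c²p, this
  -- is the product of s ≤ κc, c²(p - m) ≤ z - m and w(p) ≤ c⁵w(z), divided by c²w(p).
  have key := le_of_rightDeriv_nonpos hab
    (fun x hx => (hd x hx).continuousAt.continuousWithinAt)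
    (fun x hx => (hd x ⟨hx.1, hx.2.le⟩).hasDerivWithinAt) (fun x hx' => by
      have hx : x ∈ Icc a b := ⟨hx'.1, hx'.2.le⟩
      have hPp := sub_pos.2 (hpP x hx)
      have hp0 := hm.trans_le (hmp x hx)
      set c := √(P / (P - p x)) with hc
      have hc2 : c ^ 2 = P / (P - p x) := Real.sq_sqrt (by positivity)
      have hc1 : 1 ≤ c := by
        rw [hc, Real.one_le_sqrt, le_div_iff₀ hPp]; linarith
      have hc0 : 0 < c := by linarith
      have hzc : p x * P / (P - p x) = c ^ 2 * p x := by rw [hc2]; ring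
      have hw : weight (p x) ≤ weight (c ^ 2 * p x) * c ^ 5 := by
        rw [weight_eq_quartRoot_pow, weight_eq_quartRoot_pow, ← mul_pow]
        exact pow_le_pow_left₀ (quartRoot_pos _).le (quartRoot_le_mul hc1) 5
      have hs : s ≤ κ x * c := by
        refine (Real.sqrt_le_left (mul_nonneg (hκ0 x hx) hc0.le)).2 ?_
        rw [mul_pow, hc2]
        refine le_trans (le_of_eq ?_) (mul_le_mul_of_nonneg_right (hκ x hx) (by positivity))
        field_simp
      rw [hzc, ← hc2]
      have hwp := weight_pos (p x)
      have hwz := weight_pos (c ^ 2 * p x)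
      have hmp' := hmp x hx
      have h1 : c ^ 2 * (p x - m) ≤ c ^ 2 * p x - m := by nlinarith [one_le_pow₀ hc1 (n := 2)]
      have h2 : s * (p x - m) * (weight (p x) * c ^ 2) ≤
          (κ x * c) * (c ^ 2 * p x - m) * (weight (c ^ 2 * p x) * c ^ 5) := by
        have h3 : s * (c ^ 2 * (p x - m)) ≤ (κ x * c) * (c ^ 2 * p x - m) :=
          mul_le_mul hs h1 (mul_nonneg (by positivity) (sub_nonneg.2 hmp'))
            ((Real.sqrt_nonneg _).trans hs)
        have h4 := mul_le_mul h3 hw hwp.le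
          (le_trans (mul_nonneg (Real.sqrt_nonneg _)
            (mul_nonneg (by positivity) (sub_nonneg.2 hmp'))) h3)
        calc _ = s * (c ^ 2 * (p x - m)) * weight (p x) := by ring
          _ ≤ _ := h4
      have h5 : s * (p x - m) ≤ (c ^ 2 * p x - m) * weight (c ^ 2 * p x) *
          (κ x / weight (p x) * (c ^ 2) ^ 2) := by
        refine le_of_mul_le_mul_right ?_ (mul_pos hwp (pow_pos hc0 2))
        calc _ ≤ _ := h2
          _ = _ := by field_simp
      linarith)
  simp only [intervalIntegral.integral_same, mul_zero, zero_add] at key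
  have ha := hmp a ⟨le_rfl, hab⟩
  have h1 := monotoneOn_antitoneOn_quartRoot_add_G.2 (self_mem_Ici (a := m))
    (ha.trans (hz a ⟨le_rfl, hab⟩)) (ha.trans (hz a ⟨le_rfl, hab⟩))
  have h2 := mul_Ginf_le ((hmp b ⟨hab, le_rfl⟩).trans (hz b ⟨hab, le_rfl⟩))
  simp only at h1
  linarith

/-- The climbing estimate applied after the reflection x ↦ -x, which changes the sign of κ. -/
lemma integral_sub_le_of_fall {p κ : ℝ → ℝ} {a b k P m : ℝ} (hab : a ≤ b) (hm : 0 < m)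
    (hpc : Continuous p) (hp : ∀ x ∈ Icc a b, HasDerivAt p (κ x / weight (p x)) x) (hκ0 : ∀ x ∈ Icc a b, κ x ≤ 0)
    (hκ : ∀ x ∈ Icc a b, k * (P - p x) ≤ κ x ^ 2) (hmp : ∀ x ∈ Icc a b, m ≤ p x)
    (hpP : ∀ x ∈ Icc a b, p x < P) :
    √(k * P) * ∫ x in a..b, (p x - m) ≤ 2 * quartRoot m + m * G m - m * Ginf := by
  have hmem : ∀ x ∈ Icc (-b) (-a), -x ∈ Icc a b := fun x hx =>
    ⟨by linarith [hx.2], by linarith [hx.1]⟩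
  have h := integral_sub_le_of_climb (p := fun x => p (-x)) (κ := fun x => -κ (-x)) (a := -b)
    (b := -a) (k := k) (P := P) (neg_le_neg hab) hm (hpc.comp continuous_neg)
    (fun x hx => ((hp (-x) (hmem x hx)).comp x (hasDerivAt_neg x)).congr_deriv (by ring))
    (fun x hx => neg_nonneg.2 (hκ0 _ (hmem x hx)))
    (fun x hx => by rw [neg_sq]; exact hκ _ (hmem x hx))
    (fun x hx => hmp _ (hmem x hx)) (fun x hx => hpP _ (hmem x hx))
  rwa [intervalIntegral.integral_comp_neg (fun x => p x - m), neg_neg, neg_neg] at h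

/-- Since p ≥ 0, the bound on κ² gives |κ| ≤ √(kP), and (2q + mG)(p) changes at rate (m - p)κ. A
slow descent below m thus costs a definite amount of height. -/
lemma le_integral_sub_of_fall {p κ : ℝ → ℝ} {a b k P m : ℝ} (hab : a ≤ b)
    (hk : 0 ≤ k) (hpc : Continuous p)
    (hp : ∀ x ∈ Ico a b, HasDerivAt p (κ x / weight (p x)) x)
    (hκ : ∀ x ∈ Ico a b, κ x ^ 2 ≤ k * (P - p x)) (hp0 : ∀ x ∈ Ico a b, 0 ≤ p x)
    (hpm : ∀ x ∈ Ico a b, p x ≤ m) :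
    (2 * quartRoot (p a) + m * G (p a)) - (2 * quartRoot (p b) + m * G (p b)) ≤
      √(k * P) * ∫ x in a..b, (m - p x) := by
  set s := √(k * P)
  have h1 : ∀ x, HasDerivAt (fun x => ∫ t in a..x, (m - p t)) (m - p x) x := fun x =>
    ((continuous_const.sub hpc).integral_hasStrictDerivAt a x).hasDerivAt
  have hc : Continuous fun x => 2 * quartRoot (p x) + m * G (p x) :=
    (continuous_iff_continuousAt.2 fun y => (hasDerivAt_quartRoot_add_G m y).continuousAt).comp hpc
  have key := le_of_rightDeriv_nonneg hab
    (f := fun x => s * (∫ t in a..x, (m - p t)) + (2 * quartRoot (p x) + m * G (p x)))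
    (((continuous_iff_continuousAt.2 fun y => (h1 y).continuousAt).const_mul s).add hc).continuousOn
    (fun x hx => (((h1 x).const_mul s).add
      ((hasDerivAt_quartRoot_add_G m _).comp x (hp x hx))).hasDerivWithinAt) fun x hx => by
      have hw := (weight_pos (p x)).ne'
      have e : (m - p x) * weight (p x) * (κ x / weight (p x)) = (m - p x) * κ x := by
        field_simp
      rw [e, mul_comm s, ← mul_add]
      refine mul_nonneg (sub_nonneg.2 (hpm x hx)) ?_
      have : |κ x| ≤ s := Real.abs_le_sqrt ((hκ x hx).trans
        (mul_le_mul_of_nonneg_left (by linarith [hp0 x hx]) hk))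
      linarith [(abs_le.1 this).1]
  simp only [intervalIntegral.integral_same, mul_zero, zero_add] at key
  linarith

/-! ### The height bound for the Euler–Lagrange system -/

/-- The Euler–Lagrange system on `(0,1)` of a symmetric minimiser: `p` is the slope,
`κ = (G ∘ p)'`, and `-2ν` is the first derivative of the convex multiplier. -/
structure ElasticaSystem (p κ ν : ℝ → ℝ) : Prop where
  cont : Continuous p
  zero : p 0 = 0
  half : p (1 / 2) = 0
  deriv_p : ∀ x ∈ Ioo (0 : ℝ) 1, HasDerivAt p (κ x / weight (p x)) x
  cont_κ : ContinuousOn κ (Ioo 0 1)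
  deriv_κ : ∀ x ∈ Ioo (0 : ℝ) 1, HasDerivWithinAt κ (-(ν x / weight (p x))) (Ici x) x
  nonneg : ∀ x ∈ Ioo (0 : ℝ) (1 / 2), 0 ≤ ν x
  anti : AntitoneOn ν (Ioo 0 (1 / 2))

namespace ElasticaSystem

variable {p κ ν : ℝ → ℝ}

lemma mem_Ioo_of_half {x : ℝ} (hx : x ∈ Ioc (0 : ℝ) (1 / 2)) : x ∈ Ioo (0 : ℝ) 1 :=
  ⟨hx.1, by linarith [hx.2]⟩

lemma κ_anti (h : ElasticaSystem p κ ν) : AntitoneOn κ (Ioc 0 (1 / 2)) := by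
  intro x hx y hy hxy
  have hsub : Icc x y ⊆ Ioo (0 : ℝ) 1 := fun t ht =>
    mem_Ioo_of_half ⟨hx.1.trans_le ht.1, ht.2.trans hy.2⟩
  refine le_of_rightDeriv_nonpos hxy (h.cont_κ.mono hsub)
    (fun t ht => h.deriv_κ t (hsub ⟨ht.1, ht.2.le⟩)) fun t ht => ?_
  have := h.nonneg t ⟨hx.1.trans_le ht.1, ht.2.trans_le hy.2⟩
  have := weight_pos (p t)
  exact neg_nonpos.2 (by positivity)

/-- The right derivative of `κ² + k p`. -/
lemma deriv_energy (h : ElasticaSystem p κ ν) (k : ℝ) {x : ℝ} (hx : x ∈ Ioo (0 : ℝ) 1) :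
    HasDerivWithinAt (fun x => κ x ^ 2 + k * p x) (κ x / weight (p x) * (k - 2 * ν x))
      (Ici x) x := by
  have h1 := ((h.deriv_κ x hx).pow 2).add ((h.deriv_p x hx).hasDerivWithinAt.const_mul k)
  exact h1.congr_deriv (by push_cast; ring)

lemma cont_energy (h : ElasticaSystem p κ ν) (k : ℝ) :
    ContinuousOn (fun x => κ x ^ 2 + k * p x) (Ioo 0 1) :=
  (h.cont_κ.pow 2).add (h.cont.continuousOn.const_mul k)

lemma energy_le (h : ElasticaSystem p κ ν) {k a b : ℝ} (ha : 0 < a) (hb : b ≤ 1 / 2) (hab : a ≤ b)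
    (hk : ∀ x ∈ Ico a b, κ x * (k - 2 * ν x) ≤ 0) : κ b ^ 2 + k * p b ≤ κ a ^ 2 + k * p a := by
  have hsub : Icc a b ⊆ Ioo (0 : ℝ) 1 := fun t ht =>
    mem_Ioo_of_half ⟨ha.trans_le ht.1, ht.2.trans hb⟩
  refine le_of_rightDeriv_nonpos hab ((h.cont_energy k).mono hsub)
    (fun t ht => h.deriv_energy k (hsub ⟨ht.1, ht.2.le⟩)) fun t ht => ?_
  rw [div_mul_eq_mul_div]
  exact div_nonpos_of_nonpos_of_nonneg (hk t ht) (weight_pos _).le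

lemma le_energy (h : ElasticaSystem p κ ν) {k a b : ℝ} (ha : 0 < a) (hb : b ≤ 1 / 2) (hab : a ≤ b)
    (hk : ∀ x ∈ Ico a b, 0 ≤ κ x * (k - 2 * ν x)) : κ a ^ 2 + k * p a ≤ κ b ^ 2 + k * p b := by
  have hsub : Icc a b ⊆ Ioo (0 : ℝ) 1 := fun t ht =>
    mem_Ioo_of_half ⟨ha.trans_le ht.1, ht.2.trans hb⟩
  refine le_of_rightDeriv_nonneg hab ((h.cont_energy k).mono hsub)
    (fun t ht => h.deriv_energy k (hsub ⟨ht.1, ht.2.le⟩)) fun t ht => ?_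
  rw [div_mul_eq_mul_div]
  exact div_nonneg (hk t ht) (weight_pos _).le

lemma antitone_p (h : ElasticaSystem p κ ν) {a b : ℝ} (ha : 0 < a) (hb : b ≤ 1 / 2) (hab : a ≤ b)
    (hκ : ∀ x ∈ Ico a b, κ x ≤ 0) : p b ≤ p a :=
  le_of_rightDeriv_nonpos hab h.cont.continuousOn
    (fun t ht => (h.deriv_p t ⟨ha.trans_le ht.1, by linarith [ht.2]⟩).hasDerivWithinAt)
    fun t ht => div_nonpos_of_nonpos_of_nonneg (hκ t ht) (weight_pos _).le

lemma monotone_p (h : ElasticaSystem p κ ν) {a b : ℝ} (ha : 0 < a) (hb : b ≤ 1 / 2) (hab : a ≤ b)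
    (hκ : ∀ x ∈ Ico a b, 0 ≤ κ x) : p a ≤ p b :=
  le_of_rightDeriv_nonneg hab h.cont.continuousOn
    (fun t ht => (h.deriv_p t ⟨ha.trans_le ht.1, by linarith [ht.2]⟩).hasDerivWithinAt)
    fun t ht => div_nonneg (hκ t ht) (weight_pos _).le

/-- The height of a solution is at most half the zero of `slopeGap`. -/
lemma integral_le (h : ElasticaSystem p κ ν) {m : ℝ} (hm : 0 < m) (hgap : slopeGap m = 0) :
    ∫ x in (0 : ℝ)..(1 / 2), p x ≤ m / 2 := by
  have hint : ∀ a b, IntervalIntegrable (fun x => p x - m) volume a b := fun a b =>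
    (h.cont.sub continuous_const).intervalIntegrable a b
  have hnonpos : ∀ a b, a ≤ b → (∀ x ∈ Icc a b, p x ≤ m) → ∫ x in a..b, (p x - m) ≤ 0 :=
    fun a b hab hx => by
      have := intervalIntegral.integral_mono_on hab (hint a b)
        (intervalIntegrable_const (c := (0 : ℝ))) fun x h => sub_nonpos.2 (hx x h)
      simpa using this
  suffices hmain : ∫ x in (0 : ℝ)..(1 / 2), (p x - m) ≤ 0 by
    rw [intervalIntegral.integral_sub (h.cont.intervalIntegrable _ _)
      (intervalIntegrable_const)] at hmain
    simp at hmain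
    linarith
  obtain ⟨x₀, hx₀, hmax⟩ := isCompact_Icc.exists_isMaxOn
    (nonempty_Icc.2 (by norm_num : (0 : ℝ) ≤ 1 / 2)) h.cont.continuousOn
  have hmax' : ∀ x ∈ Icc (0 : ℝ) (1 / 2), p x ≤ p x₀ := fun x hx => hmax hx
  by_cases hPm : p x₀ ≤ m
  · exact hnonpos _ _ (by norm_num) fun x hx => (hmax' x hx).trans hPm
  push Not at hPm
  have hx₀0 : 0 < x₀ := lt_of_le_of_ne hx₀.1 fun e => by rw [← e, h.zero] at hPm; linarith
  have hx₀h : x₀ < 1 / 2 := lt_of_le_of_ne hx₀.2 fun e => by rw [e, h.half] at hPm; linarith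
  have hcrit : ∀ x ∈ Ioo (0 : ℝ) (1 / 2), p x = p x₀ → κ x = 0 := by
    intro x hx hpx
    have hloc : IsLocalMax p x := by
      filter_upwards [isOpen_Ioo.mem_nhds hx] with y hy
      rw [hpx]; exact hmax' y ⟨hy.1.le, hy.2.le⟩
    have := hloc.hasDerivAt_eq_zero (h.deriv_p x ⟨hx.1, by linarith [hx.2]⟩)
    simpa [(weight_pos (p x)).ne'] using this
  have hκ₀ := hcrit x₀ ⟨hx₀0, hx₀h⟩ rfl
  have hκpos : ∀ x ∈ Ioc 0 x₀, 0 ≤ κ x := fun x hx =>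
    hκ₀ ▸ h.κ_anti ⟨hx.1, hx.2.trans hx₀.2⟩ ⟨hx₀0, hx₀.2⟩ hx.2
  have hκneg : ∀ x ∈ Icc x₀ (1 / 2), κ x ≤ 0 := fun x hx =>
    hκ₀ ▸ h.κ_anti ⟨hx₀0, hx₀.2⟩ ⟨hx₀0.trans_le hx.1, hx.2⟩ hx.1
  obtain ⟨xr, ⟨hxr0, hxr1⟩, hxr⟩ := intermediate_value_Ioo hx₀0.le h.cont.continuousOn
    (show m ∈ Ioo (p 0) (p x₀) from ⟨by rwa [h.zero], hPm⟩)
  obtain ⟨xf, ⟨hxf0, hxf1⟩, hxf⟩ := intermediate_value_Ioo' hx₀h.le h.cont.continuousOn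
    (show m ∈ Ioo (p (1 / 2)) (p x₀) from ⟨by rwa [h.half], hPm⟩)
  set P := p x₀ with hP
  have hPm' : 0 < P - m := sub_pos.2 hPm
  -- k is the constant of the free elastica with κ² = k(P - p) that matches κ at the downward
  -- crossing.
  set k := κ xf ^ 2 / (P - m) with hk
  have hkP : k * (P - m) = κ xf ^ 2 := div_mul_cancel₀ _ hPm'.ne'
  have hκf : κ xf < 0 := by
    refine lt_of_le_of_ne (hκneg xf ⟨hxf0.le, hxf1.le⟩) fun e => ?_
    have : P ≤ p xf := h.monotone_p hx₀0 hxf1.le hxf0.le fun x hx =>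
      e ▸ h.κ_anti ⟨hx₀0.trans_le hx.1, (hx.2.trans hxf1).le⟩ ⟨hx₀0.trans hxf0, hxf1.le⟩ hx.2.le
    linarith
  have hk0 : 0 < k := div_pos (by nlinarith) hPm'
  -- If 2ν(xf) exceeded k, then κ² + 2ν(xf) p would be nondecreasing on [x₀, xf], giving 2ν(xf)(P -
  -- m) ≤ κ(xf)² = k(P - m). The bound at maximum points below is the mirror argument.
  have hνf : 2 * ν xf ≤ k := by
    by_contra! hcon
    have := h.le_energy (k := 2 * ν xf) hx₀0 hxf1.le hxf0.le fun x hx => by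
      have := h.anti ⟨hx₀0.trans_le hx.1, hx.2.trans hxf1⟩ ⟨hx₀0.trans hxf0, hxf1⟩ hx.2.le
      exact mul_nonneg_of_nonpos_of_nonpos (hκneg x ⟨hx.1, (hx.2.trans hxf1).le⟩) (by linarith)
    rw [hκ₀, hxf] at this
    nlinarith
  have hνmax : ∀ x₁ ∈ Ioo 0 xf, p x₁ = P → k ≤ 2 * ν x₁ := by
    intro x₁ hx₁ hpx
    by_contra! hcon
    have hκ₁ := hcrit x₁ ⟨hx₁.1, hx₁.2.trans hxf1⟩ hpx
    have := h.energy_le (k := 2 * ν x₁) hx₁.1 hxf1.le hx₁.2.le fun x hx => by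
      have h1 := h.anti ⟨hx₁.1, hx₁.2.trans hxf1⟩ ⟨hx₁.1.trans_le hx.1, hx.2.trans hxf1⟩ hx.1
      have h2 : κ x ≤ 0 := hκ₁ ▸ h.κ_anti ⟨hx₁.1, (hx₁.2.trans hxf1).le⟩
        ⟨hx₁.1.trans_le hx.1, (hx.2.trans hxf1).le⟩ hx.1
      exact mul_nonpos_of_nonpos_of_nonneg h2 (by linarith)
    rw [hκ₁, hpx, hxf] at this
    nlinarith
  -- Between two maximum points the antitone κ would vanish identically, yet its right derivative at
  -- the first is -ν/w < 0.
  have hunique : ∀ a b, a ∈ Ioo 0 xf → b ∈ Ioo 0 xf → a < b → p a = P → p b = P → False := by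
    intro a b ha hb hab hpa hpb
    have hκa := hcrit a ⟨ha.1, ha.2.trans hxf1⟩ hpa
    have hκb := hcrit b ⟨hb.1, hb.2.trans hxf1⟩ hpb
    have hκ : ∀ x ∈ Icc a b, κ x = 0 := fun x hx => by
      have hxm : x ∈ Ioc (0 : ℝ) (1 / 2) := ⟨ha.1.trans_le hx.1, (hx.2.trans_lt (hb.2.trans hxf1)).le⟩
      have h1 := h.κ_anti ⟨ha.1, (ha.2.trans hxf1).le⟩ hxm hx.1
      have h2 := h.κ_anti hxm ⟨hb.1, (hb.2.trans hxf1).le⟩ hx.2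
      exact le_antisymm (hκa ▸ h1) (hκb ▸ h2)
    have hd := h.deriv_κ a ⟨ha.1, by linarith [ha.2]⟩
    have hz : HasDerivWithinAt κ 0 (Ici a) a := by
      refine (hasDerivWithinAt_const a (Ici a) (0 : ℝ)).congr_of_eventuallyEq ?_ hκa
      filter_upwards [Icc_mem_nhdsGE hab] with x hx using hκ x hx
    have := (uniqueDiffWithinAt_Ici a).eq_deriv _ hd hz
    have hν := hνmax a ha hpa
    have hw := weight_pos (p a)
    have : 0 < ν a / weight (p a) := div_pos (by linarith) hw
    linarith
  have hν₀ := hνmax x₀ ⟨hx₀0, hxf0⟩ rfl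
  have hQr : ∀ x ∈ Ioc 0 x₀, k * (P - p x) ≤ κ x ^ 2 := by
    intro x hx
    have := h.energy_le (k := k) hx.1 hx₀.2 hx.2 fun y hy => by
      have h1 := h.anti ⟨hx.1.trans_le hy.1, hy.2.trans hx₀h⟩ ⟨hx₀0, hx₀h⟩ hy.2.le
      exact mul_nonpos_of_nonneg_of_nonpos (hκpos y ⟨hx.1.trans_le hy.1, hy.2.le⟩) (by linarith)
    rw [hκ₀, ← hP] at this
    linarith
  -- The energy κ² + kp equals kP at both x₀ and xf. It rises while 2ν ≥ k and falls once 2ν ≤ k, so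
  -- it stays above kP in between.
  have hQf : ∀ x ∈ Icc x₀ xf, k * (P - p x) ≤ κ x ^ 2 := by
    intro x hx
    have hx0 : 0 < x := hx₀0.trans_le hx.1
    rcases le_total k (2 * ν x) with hc | hc
    · have := h.le_energy (k := k) hx₀0 (hx.2.trans hxf1.le) hx.1 fun y hy => by
        have h1 := h.anti ⟨hx₀0.trans_le hy.1, hy.2.trans_le (hx.2.trans hxf1.le)⟩
          ⟨hx0, hx.2.trans_lt hxf1⟩ hy.2.le
        exact mul_nonneg_of_nonpos_of_nonpos
          (hκneg y ⟨hy.1, hy.2.le.trans (hx.2.trans hxf1.le)⟩) (by linarith)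
      rw [hκ₀, ← hP] at this
      linarith
    · have := h.energy_le (k := k) hx0 hxf1.le hx.2 fun y hy => by
        have h1 := h.anti ⟨hx0, hx.2.trans_lt hxf1⟩ ⟨hx0.trans_le hy.1, hy.2.trans hxf1⟩ hy.1
        exact mul_nonpos_of_nonpos_of_nonneg
          (hκneg y ⟨hx.1.trans hy.1, (hy.2.trans hxf1).le⟩) (by linarith)
      rw [hxf] at this
      linarith
  have hQe : ∀ x ∈ Icc xf (1 / 2), κ x ^ 2 ≤ k * (P - p x) := by
    intro x hx
    have hf0 : 0 < xf := hx₀0.trans hxf0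
    have := h.energy_le (k := k) hf0 hx.2 hx.1 fun y hy => by
      have h1 := h.anti ⟨hf0, hxf1⟩ ⟨hf0.trans_le hy.1, hy.2.trans_le hx.2⟩ hy.1
      exact mul_nonpos_of_nonpos_of_nonneg
        (hκneg y ⟨hxf0.le.trans hy.1, hy.2.le.trans hx.2⟩) (by linarith)
    rw [hxf] at this
    linarith
  have hlt : ∀ x ∈ Ioo 0 xf, x ≠ x₀ → p x < P := fun x hx hne =>
    lt_of_le_of_ne (hmax' x ⟨hx.1.le, (hx.2.trans hxf1).le⟩) fun e => by
      rcases lt_or_gt_of_ne hne with hc | hc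
      · exact hunique x x₀ hx ⟨hx₀0, hxf0⟩ hc e rfl
      · exact hunique x₀ x ⟨hx₀0, hxf0⟩ hx hc rfl e
  have hprim : ∀ c, Continuous fun x => ∫ t in c..x, (p t - m) := fun c =>
    intervalIntegral.continuous_primitive hint c
  set K := 2 * quartRoot m + m * G m - m * Ginf with hK
  -- The climbing estimate needs p < P strictly, so it is applied up to b < x₀ and then b → x₀.
  have hI2 : √(k * P) * ∫ x in xr..x₀, (p x - m) ≤ K := by
    refine le_of_tendsto (((hprim xr).tendsto x₀).mono_left (nhdsWithin_le_nhds (s := Iio x₀))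
      |>.const_mul _) ?_
    filter_upwards [Ioo_mem_nhdsLT hxr1] with b hb
    refine integral_sub_le_of_climb hb.1.le hm h.cont (κ := κ) (P := P)
      (fun x hx => h.deriv_p x ⟨hxr0.trans_le hx.1, by linarith [hx.2, hb.2]⟩)
      (fun x hx => hκpos x ⟨hxr0.trans_le hx.1, hx.2.trans hb.2.le⟩)
      (fun x hx => hQr x ⟨hxr0.trans_le hx.1, hx.2.trans hb.2.le⟩) (fun x hx => ?_)
      (fun x hx => hlt x ⟨hxr0.trans_le hx.1, by linarith [hx.2, hb.2]⟩
        (hx.2.trans_lt hb.2).ne)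
    rw [← hxr]
    exact h.monotone_p hxr0 ((hx.2.trans hb.2.le).trans hx₀.2) hx.1 fun y hy =>
      hκpos y ⟨hxr0.trans_le hy.1, hy.2.le.trans (hx.2.trans hb.2.le)⟩
  have hI3 : √(k * P) * ∫ x in x₀..xf, (p x - m) ≤ K := by
    have hcont : Continuous fun a => √(k * P) * ∫ x in a..xf, (p x - m) := by
      simp_rw [intervalIntegral.integral_symm xf]
      exact (hprim xf).neg.const_mul _
    refine le_of_tendsto ((hcont.tendsto x₀).mono_left (nhdsWithin_le_nhds (s := Ioi x₀))) ?_
    filter_upwards [Ioo_mem_nhdsGT hxf0] with a ha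
    refine integral_sub_le_of_fall ha.2.le hm h.cont (κ := κ) (P := P)
      (fun x hx => h.deriv_p x ⟨by linarith [hx.1, ha.1], by linarith [hx.2]⟩)
      (fun x hx => hκneg x ⟨ha.1.le.trans hx.1, hx.2.trans hxf1.le⟩)
      (fun x hx => hQf x ⟨ha.1.le.trans hx.1, hx.2⟩) (fun x hx => ?_) (fun x hx => ?_)
    · rw [← hxf]
      exact h.antitone_p (by linarith [hx.1, ha.1]) hxf1.le hx.2 fun y hy =>
        hκneg y ⟨ha.1.le.trans (hx.1.trans hy.1), (hy.2.trans hxf1).le⟩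
    · rcases eq_or_lt_of_le hx.2 with e | e
      · rw [e, hxf]; exact hPm
      · exact hlt x ⟨by linarith [hx.1, ha.1], e⟩ (ha.1.trans_le hx.1).ne'
  have hI4 := le_integral_sub_of_fall (κ := κ) (P := P) (m := m) hxf1.le hk0.le h.cont
    (fun x hx => h.deriv_p x ⟨by linarith [hx.1], by linarith [hx.2]⟩)
    (fun x hx => hQe x ⟨hx.1, hx.2.le⟩)
    (fun x hx => by
      rw [← h.half]
      exact h.antitone_p (by linarith [hx.1]) le_rfl hx.2.le fun y hy =>
        hκneg y ⟨hxf0.le.trans (hx.1.trans hy.1), hy.2.le⟩)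
    (fun x hx => by
      rw [← hxf]
      exact h.antitone_p (by linarith) hx.2.le hx.1 fun y hy =>
        hκneg y ⟨hxf0.le.trans hy.1, (hy.2.trans hx.2).le⟩)
  rw [hxf, h.half, G_zero] at hI4
  have hq0 : quartRoot 0 = 1 := by simp [quartRoot]
  rw [hq0] at hI4
  have hI1 : ∫ x in (0 : ℝ)..xr, (p x - m) ≤ 0 := hnonpos _ _ hxr0.le fun x hx => by
    rcases eq_or_lt_of_le hx.1 with e | e
    · rw [← e, h.zero]; exact hm.le
    · rw [← hxr]
      exact h.monotone_p e (hxr1.le.trans hx₀.2) hx.2 fun y hy =>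
        hκpos y ⟨e.trans_le hy.1, (hy.2.trans hxr1).le⟩
  have hsplit : ∫ x in (0 : ℝ)..(1 / 2), (p x - m) = (∫ x in (0 : ℝ)..xr, (p x - m)) +
      (∫ x in xr..x₀, (p x - m)) + (∫ x in x₀..xf, (p x - m)) - ∫ x in xf..(1 / 2), (m - p x) := by
    have e : ∫ x in xf..(1 / 2), (m - p x) = -∫ x in xf..(1 / 2), (p x - m) := by
      rw [← intervalIntegral.integral_neg]; simp
    rw [e, intervalIntegral.integral_add_adjacent_intervals (hint _ _) (hint _ _),
      intervalIntegral.integral_add_adjacent_intervals (hint _ _) (hint _ _), sub_neg_eq_add,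
      intervalIntegral.integral_add_adjacent_intervals (hint _ _) (hint _ _)]
  have hs : 0 < √(k * P) := Real.sqrt_pos.2 (mul_pos hk0 (by linarith))
  refine nonpos_of_mul_nonpos_right ?_ hs
  rw [slopeGap] at hgap
  have := mul_nonpos_of_nonneg_of_nonpos hs.le hI1
  rw [hsplit]
  linarith

end ElasticaSystem

/-! ### Test functions and weak derivatives -/

instance : IsProbabilityMeasure vol01 := ⟨by simp [vol01]⟩

namespace IsTestFunction

variable {φ χ : ℝ → ℝ}

lemma deriv (h : IsTestFunction φ) : IsTestFunction (deriv φ) :=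
  ⟨(contDiff_infty_iff_deriv.1 h.smooth).2, h.compact.deriv, tsupport_deriv_subset.trans h.support⟩

lemma differentiable (h : IsTestFunction φ) : Differentiable ℝ φ :=
  (contDiff_infty_iff_deriv.1 h.smooth).1

lemma continuous (h : IsTestFunction φ) : Continuous φ := h.smooth.continuous

lemma hasDerivAt (h : IsTestFunction φ) (x : ℝ) : HasDerivAt φ (_root_.deriv φ x) x :=
  (h.differentiable x).hasDerivAt

lemma eq_zero (h : IsTestFunction φ) {x : ℝ} (hx : x ∉ Ioo (0 : ℝ) 1) : φ x = 0 :=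
  image_eq_zero_of_notMem_tsupport fun hx' => hx (h.support hx')

lemma add_const_mul (h : IsTestFunction φ) (h' : IsTestFunction χ) (s : ℝ) :
    IsTestFunction (fun x => φ x + s * χ x) := by
  have hs : (tsupport fun x => φ x + s * χ x) ⊆ tsupport φ ∪ tsupport χ := by
    refine (tsupport_add φ fun x => s * χ x).trans (union_subset_union_right _ ?_)
    exact closure_mono fun x hx hx' => hx (by simp [hx'])
  exact ⟨h.smooth.add (contDiff_const.mul h'.smooth), h.compact.add h'.compact.mul_left,
    hs.trans (union_subset h.support h'.support)⟩

lemma deriv_add_const_mul (h : IsTestFunction φ) (h' : IsTestFunction χ) (s : ℝ) :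
    _root_.deriv (fun x => φ x + s * χ x) = fun x => _root_.deriv φ x + s * _root_.deriv χ x :=
  funext fun x => ((h.hasDerivAt x).add ((h'.hasDerivAt x).const_mul s)).deriv

lemma reflect (h : IsTestFunction φ) : IsTestFunction (fun x => φ (1 - x)) := by
  have e : tsupport (φ ∘ (Homeomorph.subLeft (1 : ℝ))) = _ := tsupport_comp_eq_preimage φ _
  refine ⟨h.smooth.comp (contDiff_const.sub contDiff_id),
    h.compact.comp_homeomorph (Homeomorph.subLeft (1 : ℝ)), fun x hx => ?_⟩
  have : 1 - x ∈ tsupport φ := by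
    have hx' : x ∈ tsupport (φ ∘ (Homeomorph.subLeft (1 : ℝ))) := hx
    rw [e] at hx'
    exact hx'
  have := h.support this
  exact ⟨by linarith [this.2], by linarith [this.1]⟩

lemma deriv_reflect (h : IsTestFunction φ) :
    _root_.deriv (fun x => φ (1 - x)) = fun x => -_root_.deriv φ (1 - x) := by
  funext x
  have := (h.hasDerivAt (1 - x)).comp x ((hasDerivAt_id' x).const_sub 1)
  rw [mul_neg_one] at this
  exact this.deriv

lemma memLp (h : IsTestFunction φ) : MemLp φ 2 vol01 :=
  (h.continuous.memLp_of_hasCompactSupport h.compact).restrict _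

lemma bounded (h : IsTestFunction φ) : ∃ C, 0 ≤ C ∧ ∀ x, |φ x| ≤ C := by
  obtain ⟨C, hC⟩ := h.compact.exists_bound_of_continuous h.continuous
  exact ⟨C, (norm_nonneg _).trans (hC 0), hC⟩

lemma integrable_mul (h : IsTestFunction φ) {f : ℝ → ℝ} (hf : LocallyIntegrableOn f (Ioo 0 1)) :
    Integrable (fun x => f x * φ x) vol01 := by
  have h1 : IntegrableOn (fun x => f x * φ x) (tsupport φ) :=
    ((hf.mono_set h.support).integrableOn_isCompact h.compact.isCompact).mul_continuousOn
      h.continuous.continuousOn h.compact.isCompact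
  refine Integrable.restrict ((integrableOn_iff_integrable_of_support_subset ?_).1 h1)
  exact fun x hx => subset_tsupport φ fun h0 => hx (by simp [h0])

lemma isWeakDeriv (h : IsTestFunction φ) : IsWeakDeriv φ (_root_.deriv φ) where
  locInt := h.continuous.locallyIntegrable.locallyIntegrableOn _
  locInt_deriv := h.deriv.continuous.locallyIntegrable.locallyIntegrableOn _
  integral_eq χ hχ := by
    have hi : ∀ {f g : ℝ → ℝ}, IsTestFunction f → IsTestFunction g →
        Integrable (fun x => f x * g x) volume := fun hf hg =>
      (hf.continuous.mul hg.continuous).integrable_of_hasCompactSupport hg.compact.mul_left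
    have := integral_mul_deriv_eq_deriv_mul_of_integrable (u := φ) (v := χ)
      (fun x _ => h.hasDerivAt x) (fun x _ => hχ.hasDerivAt x) (hi h hχ.deriv)
      (hi h.deriv hχ) (hi h hχ)
    rwa [vol01, setIntegral_eq_integral_of_forall_compl_eq_zero,
      setIntegral_eq_integral_of_forall_compl_eq_zero]
    · exact fun x hx => by rw [hχ.eq_zero hx, mul_zero]
    · exact fun x hx => by rw [hχ.deriv.eq_zero hx, mul_zero]

end IsTestFunction

namespace IsWeakDeriv

variable {u v u' v' : ℝ → ℝ}

lemma congr (h : IsWeakDeriv u v) (hu : u =ᵐ[vol01] u') (hv : v =ᵐ[vol01] v') :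
    IsWeakDeriv u' v' where
  locInt := h.locInt.congr hu
  locInt_deriv := h.locInt_deriv.congr hv
  integral_eq φ hφ := by
    rw [← integral_congr_ae (hu.mono fun x hx => by simp only [hx] :
        (fun x => u x * deriv φ x) =ᵐ[vol01] fun x => u' x * deriv φ x), h.integral_eq φ hφ,
      integral_congr_ae (hv.mono fun x hx => by simp only [hx] :
        (fun x => v x * φ x) =ᵐ[vol01] fun x => v' x * φ x)]

lemma add_const_mul (h : IsWeakDeriv u v) (h' : IsWeakDeriv u' v') (s : ℝ) :
    IsWeakDeriv (fun x => u x + s * u' x) (fun x => v x + s * v' x) where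
  locInt := h.locInt.add (h'.locInt.smul s)
  locInt_deriv := h.locInt_deriv.add (h'.locInt_deriv.smul s)
  integral_eq φ hφ := by
    have e : ∀ a b c : ℝ, (a + s * b) * c = a * c + s * (b * c) := fun a b c => by ring
    simp_rw [e]
    rw [integral_add (hφ.deriv.integrable_mul h.locInt)
        ((hφ.deriv.integrable_mul h'.locInt).const_mul s),
      integral_add (hφ.integrable_mul h.locInt_deriv)
        ((hφ.integrable_mul h'.locInt_deriv).const_mul s),
      integral_const_mul, integral_const_mul, h.integral_eq φ hφ, h'.integral_eq φ hφ]
    ring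

lemma ae_unique (h : IsWeakDeriv u v) (h' : IsWeakDeriv u v') : v =ᵐ[vol01] v' := by
  have := isOpen_Ioo.ae_eq_zero_of_integral_contDiff_smul_eq_zero
    (h.locInt_deriv.sub h'.locInt_deriv) fun g hg hgc hgs => by
      have hg' : IsTestFunction g := ⟨hg, hgc, hgs⟩
      have h1 := h.integral_eq g hg'
      rw [h'.integral_eq g hg', neg_inj] at h1
      rw [← setIntegral_eq_integral_of_forall_compl_eq_zero (s := Ioo 0 1)
        (fun x hx => by rw [hg'.eq_zero hx, zero_smul])]
      have e : ∀ x, g x • (v - v') x = v x * g x - v' x * g x := fun x => by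
        simp only [Pi.sub_apply, smul_eq_mul]; ring
      simp_rw [e]
      change ∫ x, (v x * g x - v' x * g x) ∂vol01 = 0
      rw [integral_sub (hg'.integrable_mul h.locInt_deriv) (hg'.integrable_mul h'.locInt_deriv),
        h1, sub_self]
  rw [vol01, Filter.EventuallyEq, ae_restrict_iff' measurableSet_Ioo]
  exact this.mono fun x hx hx' => sub_eq_zero.1 (hx hx')

lemma weakDeriv_spec (h : IsWeakDeriv u v) : IsWeakDeriv u (weakDeriv u) := by
  rw [weakDeriv, dif_pos ⟨v, h⟩]
  exact (⟨v, h⟩ : ∃ v, IsWeakDeriv u v).choose_spec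

lemma weakDeriv_ae_eq (h : IsWeakDeriv u v) : weakDeriv u =ᵐ[vol01] v :=
  h.weakDeriv_spec.ae_unique h

end IsWeakDeriv

/-! ### Perturbing by a test function -/

section variation

variable {u φ : ℝ → ℝ}

lemma MemH2.weakDeriv_add (hu : MemH2 u) (hφ : IsTestFunction φ) (s : ℝ) :
    weakDeriv (fun x => u x + s * φ x) =ᵐ[vol01] fun x => weakDeriv u x + s * deriv φ x :=
  (hu.weak₁.add_const_mul hφ.isWeakDeriv s).weakDeriv_ae_eq

lemma MemH2.isWeakDeriv_add (hu : MemH2 u) (hφ : IsTestFunction φ) (s : ℝ) :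
    IsWeakDeriv (weakDeriv (fun x => u x + s * φ x))
      (fun x => weakDeriv (weakDeriv u) x + s * deriv (deriv φ) x) :=
  (hu.weak₂.add_const_mul hφ.deriv.isWeakDeriv s).congr (hu.weakDeriv_add hφ s).symm
    (EventuallyEq.refl _ _)

lemma MemH2.weakDeriv_weakDeriv_add (hu : MemH2 u) (hφ : IsTestFunction φ) (s : ℝ) :
    weakDeriv (weakDeriv (fun x => u x + s * φ x)) =ᵐ[vol01]
      fun x => weakDeriv (weakDeriv u) x + s * deriv (deriv φ) x :=
  (hu.isWeakDeriv_add hφ s).weakDeriv_ae_eq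

lemma MemH2.add (hu : MemH2 u) (hφ : IsTestFunction φ) (s : ℝ) :
    MemH2 (fun x => u x + s * φ x) where
  weak₁ := (hu.weak₁.add_const_mul hφ.isWeakDeriv s).weakDeriv_spec
  weak₂ := (hu.isWeakDeriv_add hφ s).weakDeriv_spec
  memLp₀ := hu.memLp₀.add (hφ.memLp.const_mul s)
  memLp₁ := (hu.memLp₁.add (hφ.deriv.memLp.const_mul s)).ae_eq (hu.weakDeriv_add hφ s).symm
  memLp₂ := (hu.memLp₂.add (hφ.deriv.deriv.memLp.const_mul s)).ae_eq
    (hu.weakDeriv_weakDeriv_add hφ s).symm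

lemma MemH20.add (hu : MemH20 u) (hφ : IsTestFunction φ) (s : ℝ) :
    MemH20 (fun x => u x + s * φ x) where
  cont := hu.cont.add (hφ.continuous.const_mul s).continuousOn
  memH2 := hu.memH2.add hφ s
  approx ε hε := by
    obtain ⟨χ, hχ, h0, h1, h2⟩ := hu.approx ε hε
    refine ⟨_, hχ.add_const_mul hφ s, ?_, ?_, ?_⟩
    · refine lt_of_eq_of_lt (congrArg (fun f => eLpNorm f 2 vol01) (funext fun x => ?_)) h0
      simp
    · refine lt_of_eq_of_lt (eLpNorm_congr_ae ?_) h1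
      filter_upwards [hu.memH2.weakDeriv_add hφ s] with x hx
      rw [Pi.sub_apply, hx, hχ.deriv_add_const_mul hφ]
      simp
    · refine lt_of_eq_of_lt (eLpNorm_congr_ae ?_) h2
      filter_upwards [hu.memH2.weakDeriv_weakDeriv_add hφ s] with x hx
      rw [Pi.sub_apply, hx, hχ.deriv_add_const_mul hφ, hχ.deriv.deriv_add_const_mul hφ.deriv]
      simp

lemma W_add (hu : MemH2 u) (hφ : IsTestFunction φ) (s : ℝ) :
    W (fun x => u x + s * φ x) =
      ∫ x, (weakDeriv (weakDeriv u) x + s * deriv (deriv φ) x) ^ 2 /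
        (1 + (weakDeriv u x + s * deriv φ x) ^ 2) ^ (5 / 2 : ℝ) ∂vol01 := by
  refine integral_congr_ae ?_
  filter_upwards [hu.weakDeriv_add hφ s, hu.weakDeriv_weakDeriv_add hφ s] with x h1 h2
  rw [h1, h2]

end variation

/-! ### Continuous representatives of functions in H²₀ -/

section primitive

/-- The primitive, vanishing at `0`, of the restriction of `g` to `(0,1)`. -/
noncomputable def primitive01 (g : ℝ → ℝ) (x : ℝ) : ℝ := ∫ t in (0 : ℝ)..x, (Ioo 0 1).indicator g t

variable {f g : ℝ → ℝ}

lemma integrable_indicator01 (hg : Integrable g vol01) : Integrable ((Ioo 0 1).indicator g) :=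
  (integrable_indicator_iff measurableSet_Ioo).2 hg

lemma continuous_primitive01 (hg : Integrable g vol01) : Continuous (primitive01 g) :=
  intervalIntegral.continuous_primitive
    (fun _ _ => (integrable_indicator01 hg).intervalIntegrable) 0

lemma primitive01_congr (h : f =ᵐ[vol01] g) : primitive01 f = primitive01 g := by
  funext x
  refine intervalIntegral.integral_congr_ae ?_
  rw [vol01, Filter.EventuallyEq, ae_restrict_iff' measurableSet_Ioo] at h
  filter_upwards [h] with t ht _
  by_cases hm : t ∈ Ioo (0 : ℝ) 1
  · rw [indicator_of_mem hm, indicator_of_mem hm, ht hm]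
  · rw [indicator_of_notMem hm, indicator_of_notMem hm]

lemma IsTestFunction.eq_primitive01 {φ : ℝ → ℝ} (h : IsTestFunction φ) :
    primitive01 (_root_.deriv φ) = φ := by
  funext x
  have e : (Ioo 0 1).indicator (_root_.deriv φ) = _root_.deriv φ :=
    indicator_eq_self.2 fun x hx => by
      by_contra hx'
      exact hx (h.deriv.eq_zero hx')
  rw [primitive01, e, intervalIntegral.integral_deriv_eq_sub (fun x _ => h.differentiable x)
    (h.deriv.continuous.intervalIntegrable _ _), h.eq_zero (x := 0) (by simp), sub_zero]

/-- Primitives are controlled uniformly by the L¹ distance of the integrands, hence by the L²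
distance since the measure has mass one. -/
lemma enorm_primitive01_sub_le (hf : Integrable f vol01) (hg : Integrable g vol01) (x : ℝ) :
    ‖primitive01 f x - primitive01 g x‖ₑ ≤ eLpNorm (f - g) 2 vol01 := by
  have hfi := integrable_indicator01 hf
  have hgi := integrable_indicator01 hg
  have h1 : primitive01 f x - primitive01 g x =
      ∫ t in (0 : ℝ)..x, (Ioo 0 1).indicator (f - g) t := by
    rw [primitive01, primitive01, ← intervalIntegral.integral_sub hfi.intervalIntegrable
      hgi.intervalIntegrable]
    congr 1
    funext t
    rw [indicator_sub']; rfl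
  have h2 : ‖∫ t in (0 : ℝ)..x, (Ioo 0 1).indicator (f - g) t‖ₑ ≤ eLpNorm (f - g) 1 vol01 := by
    rw [← enorm_norm, intervalIntegral.norm_intervalIntegral_eq, enorm_norm]
    refine (enorm_integral_le_lintegral_enorm _).trans ((setLIntegral_le_lintegral _ _).trans ?_)
    simp_rw [enorm_indicator_eq_indicator_enorm]
    rw [lintegral_indicator measurableSet_Ioo, eLpNorm_one_eq_lintegral_enorm]
    exact le_rfl
  rw [h1]
  exact h2.trans (eLpNorm_le_eLpNorm_of_exponent_le (by norm_num)
    (hf.aestronglyMeasurable.sub hg.aestronglyMeasurable))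

/-- Closure property: a limit in `L²` of test functions whose derivatives converge in `L²` is the
primitive of the limit of the derivatives. -/
lemma ae_eq_primitive01 (hf : MemLp f 2 vol01) (hg : MemLp g 2 vol01)
    (h : ∀ ε : ℝ≥0∞, 0 < ε → ∃ φ, IsTestFunction φ ∧ eLpNorm (f - φ) 2 vol01 < ε ∧
      eLpNorm (g - deriv φ) 2 vol01 < ε) : f =ᵐ[vol01] primitive01 g := by
  have hgi : Integrable g vol01 := hg.integrable (by norm_num)
  have hpm : AEStronglyMeasurable (primitive01 g) vol01 :=
    (continuous_primitive01 hgi).aestronglyMeasurable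
  have hle : eLpNorm (f - primitive01 g) 2 vol01 ≤ 0 := by
    refine le_of_forall_pos_le_add fun ε hε => ?_
    rw [zero_add]
    obtain ⟨φ, hφ, h0, h1⟩ := h (ε / 2) (ENNReal.half_pos hε.ne')
    have h2 : eLpNorm (φ - primitive01 g) 2 vol01 ≤ ε / 2 := by
      have hb : ∀ᵐ x ∂vol01, ‖(φ - primitive01 g) x‖ₑ ≤ eLpNorm (g - deriv φ) 2 vol01 :=
        Eventually.of_forall fun x => by
          have := enorm_primitive01_sub_le hgi (hφ.deriv.memLp.integrable (by norm_num)) x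
          rw [hφ.eq_primitive01] at this
          rwa [Pi.sub_apply, enorm_sub_rev]
      refine (eLpNorm_le_of_ae_enorm_bound hb).trans ?_
      simpa using h1.le
    calc eLpNorm (f - primitive01 g) 2 vol01 = eLpNorm ((f - φ) + (φ - primitive01 g)) 2 vol01 := by
          simp
      _ ≤ eLpNorm (f - φ) 2 vol01 + eLpNorm (φ - primitive01 g) 2 vol01 :=
          eLpNorm_add_le (hf.1.sub hφ.memLp.1) (hφ.memLp.1.sub hpm) (by norm_num)
      _ ≤ ε / 2 + ε / 2 := add_le_add h0.le h2
      _ = ε := ENNReal.add_halves ε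
  have h0 := (eLpNorm_eq_zero_iff (hf.1.sub hpm) (by norm_num)).1 (le_antisymm hle bot_le)
  exact h0.mono fun x hx => sub_eq_zero.1 hx

end primitive

/-- The continuous representative of the first weak derivative. -/
noncomputable def slopeRep (u : ℝ → ℝ) : ℝ → ℝ := primitive01 (weakDeriv (weakDeriv u))

namespace MemH20

variable {u : ℝ → ℝ}

lemma integrable_weakDeriv_weakDeriv (hu : MemH20 u) :
    Integrable (weakDeriv (weakDeriv u)) vol01 := hu.memH2.memLp₂.integrable (by norm_num)

lemma continuous_slopeRep (hu : MemH20 u) : Continuous (slopeRep u) :=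
  continuous_primitive01 hu.integrable_weakDeriv_weakDeriv

/-- Approximation by test functions fixes the constant of integration: it encodes the boundary
condition u'(0) = 0. -/
lemma weakDeriv_ae_eq (hu : MemH20 u) : weakDeriv u =ᵐ[vol01] slopeRep u := by
  refine ae_eq_primitive01 hu.memH2.memLp₁ hu.memH2.memLp₂ fun ε hε => ?_
  obtain ⟨φ, hφ, -, h1, h2⟩ := hu.approx ε hε
  exact ⟨_, hφ.deriv, h1, h2⟩

lemma eq_integral (hu : MemH20 u) {x : ℝ} (hx : x ∈ Icc (0 : ℝ) 1) :
    u x = ∫ t in (0 : ℝ)..x, slopeRep u t := by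
  have h1 : u =ᵐ[vol01] primitive01 (weakDeriv u) := by
    refine ae_eq_primitive01 hu.memH2.memLp₀ hu.memH2.memLp₁ fun ε hε => ?_
    obtain ⟨φ, hφ, h0, h1, -⟩ := hu.approx ε hε
    exact ⟨_, hφ, h0, h1⟩
  rw [primitive01_congr hu.weakDeriv_ae_eq, vol01, restrict_Ioo_eq_restrict_Icc] at h1
  have hi : Integrable (slopeRep u) vol01 :=
    (hu.memH2.memLp₁.integrable (by norm_num)).congr hu.weakDeriv_ae_eq
  have h2 : u x = primitive01 (slopeRep u) x := Measure.eqOn_Icc_of_ae_eq volume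
    zero_ne_one h1 hu.cont (continuous_primitive01 hi).continuousOn hx
  rw [h2, primitive01]
  refine intervalIntegral.integral_congr_ae ?_
  filter_upwards [Measure.ae_ne volume 1] with t ht ht'
  rw [uIoc_of_le hx.1] at ht'
  have hm : t ∈ Ioo (0 : ℝ) 1 := ⟨ht'.1, lt_of_le_of_ne (ht'.2.trans hx.2) ht⟩
  rw [indicator_of_mem hm]

lemma hasDerivAt (hu : MemH20 u) {x : ℝ} (hx : x ∈ Ioo (0 : ℝ) 1) :
    HasDerivAt u (slopeRep u x) x := by
  have := (hu.continuous_slopeRep.integral_hasStrictDerivAt 0 x).hasDerivAt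
  refine this.congr_of_eventuallyEq ?_
  filter_upwards [isOpen_Ioo.mem_nhds hx] with y hy using hu.eq_integral ⟨hy.1.le, hy.2.le⟩

lemma ae_hasDerivAt_slopeRep (hu : MemH20 u) :
    ∀ᵐ x ∂vol01, HasDerivAt (slopeRep u) (weakDeriv (weakDeriv u) x) x := by
  rw [vol01, ae_restrict_iff' measurableSet_Ioo]
  filter_upwards [LocallyIntegrable.ae_hasDerivAt_integral (integrable_indicator01
    hu.integrable_weakDeriv_weakDeriv).locallyIntegrable] with x hx hx'
  have := hx 0
  rwa [indicator_of_mem hx'] at this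

end MemH20

/-! ### Nonnegative second distributional derivative implies convexity -/

/-- A sequence of functions, eventually convex on compact subintervals of `(0,1)` and converging
on a dense set, has a convex limit. -/
lemma exists_convexOn_limit {f : ℕ → ℝ → ℝ} {g : ℝ → ℝ} {S : Set ℝ}
    (hconv : ∀ a ∈ Ioo (0 : ℝ) (1 / 2), ∀ᶠ n in atTop, ConvexOn ℝ (Ioo a (1 - a)) (f n))
    (hS : ∀ x y : ℝ, 0 ≤ x → x < y → y ≤ 1 → ∃ s ∈ S, s ∈ Ioo x y)
    (hlim : ∀ s ∈ S, Tendsto (fun n => f n s) atTop (𝓝 (g s))) :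
    ∃ h : ℝ → ℝ, ConvexOn ℝ (Ioo 0 1) h ∧ ∀ s ∈ S ∩ Ioo 0 1, g s = h s := by
  have hbd : ∀ s ∈ S, ∃ C, ∀ᶠ n in atTop, |f n s| ≤ C := fun s hs =>
    ⟨|g s| + 1, ((hlim s hs).abs.eventually (gt_mem_nhds (lt_add_one _))).mono fun n hn => hn.le⟩
  -- Limits along an ultrafilter exist at every point where the sequence is bounded, and they
  -- preserve convexity and the given limits.
  have hle : ((hyperfilter ℕ : Ultrafilter ℕ) : Filter ℕ) ≤ atTop := Nat.hyperfilter_le_atTop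
  have hex : ∀ x ∈ Ioo (0 : ℝ) 1, ∃ y, Tendsto (fun n => f n x) (hyperfilter ℕ) (𝓝 y) := by
    intro x hx
    -- With s₀ < s₁ < x < s₂, convexity on [s₁, s₂] bounds f n x above, and s₁ as a convex
    -- combination of s₀ and x bounds it below.
    obtain ⟨s₁, hs₁, h01, h1x⟩ := hS 0 x le_rfl hx.1 hx.2.le
    obtain ⟨s₀, hs₀, h00, h01'⟩ := hS 0 s₁ le_rfl h01 (h1x.trans hx.2).le
    obtain ⟨s₂, hs₂, hx2, h21⟩ := hS x 1 hx.1.le hx.2 le_rfl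
    obtain ⟨C₀, hC₀⟩ := hbd s₀ hs₀
    obtain ⟨C₁, hC₁⟩ := hbd s₁ hs₁
    obtain ⟨C₂, hC₂⟩ := hbd s₂ hs₂
    set a := min (s₀ / 2) ((1 - s₂) / 2) with ha
    have ha1 : a ≤ s₀ / 2 := min_le_left _ _
    have ha2 : a ≤ (1 - s₂) / 2 := min_le_right _ _
    have ha0 : 0 < a := lt_min (by linarith) (by linarith)
    set t := (x - s₁) / (x - s₀) with ht
    have hx0 : 0 < x - s₀ := by linarith
    have ht0 : 0 < t := div_pos (by linarith) hx0
    have ht1 : t < 1 := by rw [ht, div_lt_one hx0]; linarith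
    have hcomb : t * s₀ + (1 - t) * x = s₁ := by
      rw [ht]; field_simp; ring
    have hbound : ∀ᶠ n in atTop, f n x ∈ Icc (-((C₁ + t * C₀) / (1 - t))) (C₁ + C₂) := by
      filter_upwards [hC₀, hC₁, hC₂, hconv a ⟨ha0, by linarith⟩] with n h0 h1 h2 hn
      have m0 : s₀ ∈ Ioo a (1 - a) := ⟨by linarith, by linarith⟩
      have m1 : s₁ ∈ Ioo a (1 - a) := ⟨by linarith, by linarith⟩
      have m2 : s₂ ∈ Ioo a (1 - a) := ⟨by linarith, by linarith⟩
      have mx : x ∈ Ioo a (1 - a) := ⟨by linarith, by linarith⟩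
      rw [abs_le] at h0 h1 h2
      constructor
      · have := hn.2 m0 mx ht0.le (sub_nonneg.2 ht1.le) (by ring)
        simp only [smul_eq_mul] at this
        rw [hcomb] at this
        rw [neg_le_iff_add_nonneg, ← sub_nonneg]
        have h3 : 0 ≤ (1 - t) * f n x + (C₁ + t * C₀) := by nlinarith
        have h4 : f n x + (C₁ + t * C₀) / (1 - t) =
            ((1 - t) * f n x + (C₁ + t * C₀)) / (1 - t) := by
          have := (sub_pos.2 ht1).ne'
          field_simp
        rw [sub_zero, h4]
        exact div_nonneg h3 (sub_nonneg.2 ht1.le)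
      · have := hn.le_max_of_mem_Icc m1 m2 ⟨h1x.le, hx2.le⟩
        rcases le_max_iff.1 this with h | h <;> linarith
    obtain ⟨y, -, hy⟩ := isCompact_Icc.ultrafilter_le_nhds' ((hyperfilter ℕ).map fun n => f n x)
      (hle hbound)
    exact ⟨y, hy⟩
  choose! h hh using hex
  refine ⟨h, ⟨convex_Ioo 0 1, fun x hx y hy α β hα hβ hαβ => ?_⟩, fun s hs =>
    tendsto_nhds_unique ((hlim s hs.1).mono_left hle) (hh s hs.2)⟩
  have hz : α • x + β • y ∈ Ioo (0 : ℝ) 1 := convex_Ioo 0 1 hx hy hα hβ hαβ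
  refine le_of_tendsto_of_tendsto (hh _ hz) (((hh x hx).const_smul α).add ((hh y hy).const_smul β)) ?_
  set a := min (min (x / 2) ((1 - x) / 2)) (min (y / 2) ((1 - y) / 2)) with ha
  have h1 : a ≤ x / 2 := (min_le_left _ _).trans (min_le_left _ _)
  have h2 : a ≤ (1 - x) / 2 := (min_le_left _ _).trans (min_le_right _ _)
  have h3 : a ≤ y / 2 := (min_le_right _ _).trans (min_le_left _ _)
  have h4 : a ≤ (1 - y) / 2 := (min_le_right _ _).trans (min_le_right _ _)
  have ha0 : 0 < a := lt_min (lt_min (by linarith [hx.1]) (by linarith [hx.2]))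
    (lt_min (by linarith [hy.1]) (by linarith [hy.2]))
  refine hle ((hconv a ⟨ha0, by linarith [hx.1, hx.2]⟩).mono fun n hn => ?_)
  exact hn.2 ⟨by linarith [hx.1], by linarith [hx.2]⟩ ⟨by linarith [hy.1], by linarith [hy.2]⟩ hα hβ hαβ

/-- The mollifiers. -/
noncomputable def mollifier (n : ℕ) : ContDiffBump (0 : ℝ) where
  rIn := 1 / (n + 1 : ℝ) / 2
  rOut := 1 / (n + 1 : ℝ)
  rIn_pos := by positivity
  rIn_lt_rOut := half_lt_self (by positivity)

/-- A distribution on `(0,1)` with nonnegative second derivative, given by an integrable function,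
is a convex function. -/
lemma exists_convexOn_ae_eq {F : ℝ → ℝ} (hF : Integrable F vol01)
    (h : ∀ φ : ℝ → ℝ, IsTestFunction φ → (∀ x, 0 ≤ φ x) →
      0 ≤ ∫ x, F x * deriv (deriv φ) x ∂vol01) :
    ∃ C : ℝ → ℝ, ConvexOn ℝ (Ioo 0 1) C ∧ F =ᵐ[vol01] C := by
  set F₀ := (Ioo (0 : ℝ) 1).indicator F with hF₀
  have hloc : LocallyIntegrable F₀ := (integrable_indicator01 hF).locallyIntegrable
  set L : ℝ →L[ℝ] ℝ →L[ℝ] ℝ := ContinuousLinearMap.lsmul ℝ ℝ with hL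
  set ρ : ℕ → ℝ → ℝ := fun n => (mollifier n).normed volume with hρ
  have hρs : ∀ n, ContDiff ℝ ∞ (ρ n) := fun n => (mollifier n).contDiff_normed
  have hρc : ∀ n, HasCompactSupport (ρ n) := fun n => (mollifier n).hasCompactSupport_normed
  have hρ's : ∀ n, ContDiff ℝ ∞ (deriv (ρ n)) := fun n => (contDiff_infty_iff_deriv.1 (hρs n)).2
  set f : ℕ → ℝ → ℝ := fun n => convolution (ρ n) F₀ L volume with hf
  have hd1 : ∀ n x, HasDerivAt (f n) (convolution (deriv (ρ n)) F₀ L volume x) x := fun n x =>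
    (hρc n).hasDerivAt_convolution_left L ((hρs n).of_le (by exact_mod_cast le_top)) hloc x
  have hd2 : ∀ n x, HasDerivAt (convolution (deriv (ρ n)) F₀ L volume)
      (convolution (deriv (deriv (ρ n))) F₀ L volume x) x := fun n x =>
    (hρc n).deriv.hasDerivAt_convolution_left L ((hρ's n).of_le (by exact_mod_cast le_top)) hloc x
  have htend : Tendsto (fun n : ℕ => 1 / ((n : ℝ) + 1)) atTop (𝓝 0) :=
    tendsto_one_div_add_atTop_nhds_zero_nat
  have hconv : ∀ a ∈ Ioo (0 : ℝ) (1 / 2), ∀ᶠ n in atTop, ConvexOn ℝ (Ioo a (1 - a)) (f n) := by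
    intro a ha
    filter_upwards [htend.eventually (gt_mem_nhds ha.1)] with n hn
    have hdf : deriv (f n) = convolution (deriv (ρ n)) F₀ L volume :=
      funext fun x => (hd1 n x).deriv
    refine convexOn_of_deriv2_nonneg' (convex_Ioo _ _)
      (fun x _ => (hd1 n x).differentiableAt.differentiableWithinAt)
      (fun x _ => by rw [hdf]; exact (hd2 n x).differentiableAt.differentiableWithinAt)
      fun x hx => ?_
    have e1 : deriv^[2] (f n) x = convolution (deriv (deriv (ρ n))) F₀ L volume x := by
      change deriv (deriv (f n)) x = _
      rw [hdf, (hd2 n x).deriv]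
    -- The radius 1/(n + 1) is below a, so the bump centred at x ∈ (a, 1 - a) is supported in (0,1).
    -- The hypothesis on F is then exactly that the mollified function has nonnegative second
    -- derivative at x.
    have hφ : IsTestFunction fun y => ρ n (x - y) := by
      refine ⟨(hρs n).comp (contDiff_const.sub contDiff_id),
        (hρc n).comp_homeomorph (Homeomorph.subLeft x), fun y hy => ?_⟩
      have e : tsupport (ρ n ∘ (Homeomorph.subLeft x)) = _ := tsupport_comp_eq_preimage (ρ n) _
      have hy' : y ∈ tsupport (ρ n ∘ (Homeomorph.subLeft x)) := hy
      rw [e, hρ, (mollifier n).tsupport_normed_eq] at hy'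
      have hy2 : |x - y| ≤ 1 / ((n : ℝ) + 1) := by
        have : dist (x - y) 0 ≤ (mollifier n).rOut := hy'
        rwa [Real.dist_eq, sub_zero] at this
      have := abs_le.1 hy2
      exact ⟨by linarith [hx.1], by linarith [hx.2]⟩
    have hdd : ∀ ψ : ℝ → ℝ, Differentiable ℝ ψ →
        deriv (fun y => ψ (x - y)) = fun y => -deriv ψ (x - y) := fun ψ hψ => funext fun y => by
      have := (hψ (x - y)).hasDerivAt.comp y ((hasDerivAt_id' y).const_sub x)
      rw [mul_neg_one] at this
      exact this.deriv
    have hφ2 : deriv (deriv fun y => ρ n (x - y)) = fun y => deriv (deriv (ρ n)) (x - y) := by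
      rw [hdd _ (contDiff_infty_iff_deriv.1 (hρs n)).1]
      funext y
      rw [deriv.fun_neg, hdd _ (contDiff_infty_iff_deriv.1 (hρ's n)).1, neg_neg]
    have := h _ hφ fun y => (mollifier n).nonneg_normed _
    rw [hφ2] at this
    rw [e1, convolution_eq_swap]
    refine this.trans_eq ?_
    rw [vol01, ← integral_indicator measurableSet_Ioo]
    refine integral_congr_ae (Eventually.of_forall fun y => ?_)
    by_cases hy : y ∈ Ioo (0 : ℝ) 1
    · simp [hy, hF₀, hL, mul_comm]
    · simp [hy, hF₀]
  have hae : ∀ᵐ x, Tendsto (fun n => f n x) atTop (𝓝 (F₀ x)) :=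
    ContDiffBump.ae_convolution_tendsto_right_of_locallyIntegrable (φ := mollifier) (K := 2) htend
      (Eventually.of_forall fun n => by simp only [mollifier]; linarith) hloc
  obtain ⟨C, hC, hCeq⟩ := exists_convexOn_limit hconv (S := {x | Tendsto (fun n => f n x) atTop
    (𝓝 (F₀ x))}) (g := F₀) (fun x y _ hxy _ => by
      have hne : (ae (volume.restrict (Ioo x y))).NeBot := by
        rw [ae_neBot, Ne, Measure.restrict_eq_zero]
        simp [hxy]
      obtain ⟨s, hs1, hs2⟩ := ((ae_restrict_of_ae hae).and (ae_restrict_mem measurableSet_Ioo)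
        : ∀ᵐ s ∂(volume.restrict (Ioo x y)), _).exists
      exact ⟨s, hs1, hs2⟩) (fun s hs => hs)
  refine ⟨C, hC, ?_⟩
  rw [vol01, Filter.EventuallyEq, ae_restrict_iff' measurableSet_Ioo]
  filter_upwards [hae] with x hx hx'
  rw [← hCeq x ⟨hx, hx'⟩, hF₀, indicator_of_mem hx']

/-! ### Reflection and the first variation -/

lemma measurePreserving_reflect : MeasurePreserving (fun x : ℝ => 1 - x) vol01 vol01 := by
  have h := (volume.measurePreserving_sub_left (1 : ℝ)).restrict_preimage
    (measurableSet_Ioo (a := (0 : ℝ)) (b := 1))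
  have e : (fun x : ℝ => 1 - x) ⁻¹' Ioo 0 1 = Ioo 0 1 := by
    ext x; simp
  rwa [e] at h

lemma integral_reflect (f : ℝ → ℝ) : ∫ x, f (1 - x) ∂vol01 = ∫ x, f x ∂vol01 :=
  measurePreserving_reflect.integral_comp (Homeomorph.subLeft (1 : ℝ)).measurableEmbedding f

lemma ae_reflect {q : ℝ → Prop} (h : ∀ᵐ x ∂vol01, q x) : ∀ᵐ x ∂vol01, q (1 - x) :=
  measurePreserving_reflect.quasiMeasurePreserving.ae h

lemma ae_mem_Ioo : ∀ᵐ x ∂vol01, x ∈ Ioo (0 : ℝ) 1 := ae_restrict_mem measurableSet_Ioo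

lemma continuous_quartRoot : Continuous quartRoot :=
  continuous_iff_continuousAt.2 fun t => (hasDerivAt_quartRoot t).continuousAt

lemma one_div_rpow_eq (t : ℝ) : 1 / (1 + t ^ 2) ^ (5 / 2 : ℝ) = quartRoot t ^ 10 := by
  have h := (one_add_sq_pos t).le
  rw [quartRoot, ← Real.rpow_mul_natCast h, one_div, ← Real.rpow_neg h]
  norm_num

/-- Already |t| q(t)² ≤ 1. This bound, uniform in the slope, dominates the slope derivative of the
energy density by a multiple of u''². -/
lemma abs_mul_quartRoot_pow_le (t : ℝ) : |t * quartRoot t ^ 14| ≤ 1 := by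
  have h0 := quartRoot_pos t
  have h1 := quartRoot_le_one t
  have h2 : |t| * quartRoot t ^ 2 ≤ 1 := by
    refine le_of_sq_le_sq ?_ zero_le_one
    rw [mul_pow, sq_abs, ← pow_mul, quartRoot_pow_four, one_pow, ← div_eq_mul_inv,
      div_le_one (one_add_sq_pos t)]
    linarith
  rw [abs_mul, abs_of_pos (pow_pos h0 14)]
  calc |t| * quartRoot t ^ 14 = |t| * quartRoot t ^ 2 * quartRoot t ^ 12 := by ring
    _ ≤ 1 * 1 := mul_le_mul h2 (pow_le_one₀ h0.le h1) (by positivity) zero_le_one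
    _ = 1 := one_mul 1

lemma hasDerivAt_quartRoot_pow_ten (t : ℝ) :
    HasDerivAt (fun t => quartRoot t ^ 10) (-5 * (t * quartRoot t ^ 14)) t := by
  refine ((hasDerivAt_quartRoot t).pow 10).congr_deriv ?_
  rw [weight_eq_quartRoot_pow]
  push_cast
  ring

/-- Differentiation of the energy along `(c + s d, a + s b)`. -/
lemma hasDerivAt_energy {a b c d : ℝ → ℝ} (ha : MemLp a 2 vol01)
    (hc : AEStronglyMeasurable c vol01) (hb : IsTestFunction b) (hd : IsTestFunction d) :
    HasDerivAt (fun s : ℝ => ∫ x, (a x + s * b x) ^ 2 * quartRoot (c x + s * d x) ^ 10 ∂vol01)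
      (∫ x, (2 * a x * b x * quartRoot (c x) ^ 10 -
        5 * a x ^ 2 * (c x * quartRoot (c x) ^ 14) * d x) ∂vol01) 0 := by
  obtain ⟨B, hB0, hB⟩ := hb.bounded
  obtain ⟨D, hD0, hD⟩ := hd.bounded
  have hbm : AEStronglyMeasurable b vol01 := hb.continuous.aestronglyMeasurable
  have hdm : AEStronglyMeasurable d vol01 := hd.continuous.aestronglyMeasurable
  have hqm : ∀ {f : ℝ → ℝ}, AEStronglyMeasurable f vol01 →
      AEStronglyMeasurable (fun x => quartRoot (f x)) vol01 := fun hf =>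
    continuous_quartRoot.comp_aestronglyMeasurable hf
  set F : ℝ → ℝ → ℝ := fun s x => (a x + s * b x) ^ 2 * quartRoot (c x + s * d x) ^ 10 with hF
  set F' : ℝ → ℝ → ℝ := fun s x => 2 * (a x + s * b x) * b x * quartRoot (c x + s * d x) ^ 10 -
    5 * (a x + s * b x) ^ 2 * ((c x + s * d x) * quartRoot (c x + s * d x) ^ 14) * d x with hF'
  have ham := ha.1
  have hmeas : ∀ s, AEStronglyMeasurable (F s) vol01 := fun s =>
    ((ham.add (hbm.const_mul s)).pow 2).mul ((hqm (hc.add (hdm.const_mul s))).pow 10)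
  have hsq : Integrable (fun x => (|a x| + B) ^ 2) vol01 :=
    (ha.norm.add (memLp_const B)).integrable_sq
  have habs : Integrable (fun x => |a x| + B) vol01 :=
    (ha.norm.add (memLp_const B)).integrable (by norm_num)
  have hle : ∀ s, |s| ≤ 1 → ∀ x, |a x + s * b x| ≤ |a x| + B := fun s hs x => by
    refine (abs_add_le _ _).trans (add_le_add_right ?_ _)
    rw [abs_mul]
    calc |s| * |b x| ≤ 1 * B := mul_le_mul hs (hB x) (abs_nonneg _) zero_le_one
      _ = B := one_mul B
  have hq : ∀ t (n : ℕ), |quartRoot t ^ n| ≤ 1 := fun t n => by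
    rw [abs_of_pos (pow_pos (quartRoot_pos t) n)]
    exact pow_le_one₀ (quartRoot_pos t).le (quartRoot_le_one t)
  have key := hasDerivAt_integral_of_dominated_loc_of_deriv_le (μ := vol01) (F := F) (F' := F')
    (x₀ := (0 : ℝ)) (s := Metric.ball 0 1)
    (bound := fun x => 2 * B * (|a x| + B) + 5 * D * (|a x| + B) ^ 2)
    (Metric.ball_mem_nhds 0 one_pos) (Eventually.of_forall hmeas) ?_ ?_
    (Eventually.of_forall fun x s hs => ?_) ((habs.const_mul _).add (hsq.const_mul _))
    (Eventually.of_forall fun x s _ => ?_)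
  · simpa [hF, hF'] using key.2
  · refine hsq.mono' (hmeas 0) (Eventually.of_forall fun x => ?_)
    rw [Real.norm_eq_abs, hF, abs_mul, abs_pow]
    calc _ ≤ (|a x| + B) ^ 2 * 1 := mul_le_mul
          (pow_le_pow_left₀ (abs_nonneg _) (hle 0 (by simp) x) 2) (hq _ _) (abs_nonneg _)
          (by positivity)
      _ = _ := mul_one _
  · have hcq : AEStronglyMeasurable (fun x => quartRoot (c x + 0 * d x)) vol01 :=
      hqm (hc.add (hdm.const_mul 0))
    exact (((((ham.add (hbm.const_mul 0)).const_mul 2).mul hbm).mul (hcq.pow 10)).sub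
      (((((ham.add (hbm.const_mul 0)).pow 2).const_mul 5).mul
        ((hc.add (hdm.const_mul 0)).mul (hcq.pow 14))).mul hdm))
  · have hs' : |s| ≤ 1 := by
      rw [mem_ball_zero_iff, Real.norm_eq_abs] at hs
      exact hs.le
    have h1 := hle s hs' x
    have h0 : 0 ≤ |a x| + B := (abs_nonneg _).trans h1
    rw [Real.norm_eq_abs, hF']
    refine (abs_sub _ _).trans (add_le_add ?_ ?_)
    · rw [abs_mul, abs_mul, abs_mul, abs_two]
      calc 2 * |a x + s * b x| * |b x| * |quartRoot (c x + s * d x) ^ 10|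
          ≤ 2 * (|a x| + B) * B * 1 := by
            gcongr
            · exact hB x
            · exact hq _ _
        _ = _ := by ring
    · rw [abs_mul, abs_mul, abs_mul, abs_pow, abs_of_pos (by norm_num : (0 : ℝ) < 5)]
      calc 5 * |a x + s * b x| ^ 2 * |(c x + s * d x) * quartRoot (c x + s * d x) ^ 14| * |d x|
          ≤ 5 * (|a x| + B) ^ 2 * 1 * D := by
            gcongr
            · exact abs_mul_quartRoot_pow_le _
            · exact hD x
        _ = _ := by ring
  · have ha' : HasDerivAt (fun s => a x + s * b x) (b x) s := by
      simpa using ((hasDerivAt_id s).mul_const (b x)).const_add (a x)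
    have hc' : HasDerivAt (fun s => c x + s * d x) (d x) s := by
      simpa using ((hasDerivAt_id s).mul_const (d x)).const_add (c x)
    refine ((ha'.pow 2).mul ((hasDerivAt_quartRoot_pow_ten _).comp s hc')).congr_deriv ?_
    simp only [hF', Function.comp, Pi.pow_apply]
    push_cast
    ring

lemma add_mem_admissible {ψ u φ : ℝ → ℝ} (hu : u ∈ admissible ψ) (hφ : IsTestFunction φ)
    (hsymm : ∀ x, φ (1 - x) = φ x) (hnn : ∀ x, 0 ≤ φ x) {s : ℝ} (hs : 0 ≤ s) :
    (fun x => u x + s * φ x) ∈ admissible ψ := by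
  refine ⟨hu.1.add hφ s, fun x hx => ?_⟩
  obtain ⟨h1, h2⟩ := hu.2 x hx
  refine ⟨by simp only [hsymm, h1], ?_⟩
  have := mul_nonneg hs (hnn x)
  linarith

/-- The first variation of `W` at a minimiser in a symmetric nonnegative direction. -/
lemma IsMinimiser.variation_nonneg {ψ u φ : ℝ → ℝ} (hu : IsMinimiser ψ u) (hφ : IsTestFunction φ)
    (hsymm : ∀ x, φ (1 - x) = φ x) (hnn : ∀ x, 0 ≤ φ x) :
    0 ≤ ∫ x, (2 * weakDeriv (weakDeriv u) x * deriv (deriv φ) x * quartRoot (weakDeriv u x) ^ 10 -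
        5 * weakDeriv (weakDeriv u) x ^ 2 * (weakDeriv u x * quartRoot (weakDeriv u x) ^ 14) *
          deriv φ x) ∂vol01 := by
  have hm := hu.1.1.memH2
  have hd := hasDerivAt_energy hm.memLp₂ hm.memLp₁.1 hφ.deriv.deriv hφ.deriv
  have hW : ∀ s, W (fun x => u x + s * φ x) = ∫ x, (weakDeriv (weakDeriv u) x +
      s * deriv (deriv φ) x) ^ 2 * quartRoot (weakDeriv u x + s * deriv φ x) ^ 10 ∂vol01 := by
    intro s
    rw [W_add hm hφ]
    simp_rw [← one_div_rpow_eq, mul_one_div]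
  simp_rw [← hW] at hd
  -- Only s > 0 is sure to keep u + sφ above the obstacle, so minimality yields an inequality for
  -- the right difference quotients.
  have hmin : ∀ s ∈ Ioi (0 : ℝ), W (fun x => u x + 0 * φ x) ≤ W (fun x => u x + s * φ x) := by
    intro s hs
    simpa using hu.2 _ (add_mem_admissible hu.1 hφ hsymm hnn (le_of_lt hs))
  have hlim := (hasDerivWithinAt_iff_tendsto_slope' (by simp)).1 (hd.hasDerivWithinAt (s := Ioi 0))
  refine ge_of_tendsto hlim ?_
  filter_upwards [self_mem_nhdsWithin] with s hs
  rw [slope_def_field]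
  exact div_nonneg (sub_nonneg.2 (hmin s hs)) (by rw [sub_zero]; exact le_of_lt hs)

/-- Integration by parts against a test function. -/
lemma integral_primitive01_mul_deriv {g φ : ℝ → ℝ} (hg : Integrable g vol01)
    (hφ : IsTestFunction φ) :
    ∫ x, primitive01 g x * deriv φ x ∂vol01 = -∫ x, g x * φ x ∂vol01 := by
  have hgi := integrable_indicator01 hg
  have h1 : AbsolutelyContinuousOnInterval (primitive01 g) 0 1 :=
    hgi.intervalIntegrable.absolutelyContinuousOnInterval_intervalIntegral (by simp)
  have h2 : AbsolutelyContinuousOnInterval φ 0 1 :=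
    (hφ.smooth.of_le (by exact_mod_cast le_top)).contDiffOn.absolutelyContinuousOnInterval
  have h := h1.integral_mul_deriv_eq_deriv_mul h2
  rw [hφ.eq_zero (x := 0) (by simp), hφ.eq_zero (x := 1) (by simp)] at h
  have e : ∀ f : ℝ → ℝ, ∫ x in (0 : ℝ)..1, f x = ∫ x, f x ∂vol01 := fun f => by
    rw [intervalIntegral.integral_of_le zero_le_one, integral_Ioc_eq_integral_Ioo, vol01]
  rw [e, e] at h
  rw [h, mul_zero, mul_zero, sub_zero, zero_sub]
  congr 1
  refine integral_congr_ae ?_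
  rw [vol01, Filter.EventuallyEq, ae_restrict_iff' measurableSet_Ioo]
  filter_upwards [LocallyIntegrable.ae_hasDerivAt_integral hgi.locallyIntegrable] with x hx hx'
  have := (hx 0).deriv
  rw [indicator_of_mem hx'] at this
  change deriv (fun y => ∫ t in (0 : ℝ)..y, (Ioo 0 1).indicator g t) x * φ x = _
  rw [this]

/-- At a negative interior minimum κ vanishes and is nonpositive afterwards, so p could not return
to 0 at 1/2. -/
lemma ElasticaSystem.nonneg_p {p κ ν : ℝ → ℝ} (h : ElasticaSystem p κ ν) {x : ℝ}
    (hx : x ∈ Icc (0 : ℝ) (1 / 2)) : 0 ≤ p x := by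
  obtain ⟨y, hy, hmin⟩ := isCompact_Icc.exists_isMinOn
    (nonempty_Icc.2 (by norm_num : (0 : ℝ) ≤ 1 / 2)) h.cont.continuousOn
  refine le_trans ?_ (hmin hx)
  by_contra! hneg
  have hy0 : 0 < y := lt_of_le_of_ne hy.1 fun e => by rw [← e, h.zero] at hneg; exact lt_irrefl _ hneg
  have hy1 : y < 1 / 2 := lt_of_le_of_ne hy.2 fun e => by
    rw [e, h.half] at hneg; exact lt_irrefl _ hneg
  have hloc : IsLocalMin p y := by
    filter_upwards [isOpen_Ioo.mem_nhds (⟨hy0, hy1⟩ : y ∈ Ioo (0 : ℝ) (1 / 2))] with z hz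
    exact hmin ⟨hz.1.le, hz.2.le⟩
  have hκ : κ y = 0 := by
    have := hloc.hasDerivAt_eq_zero (h.deriv_p y ⟨hy0, by linarith⟩)
    simpa [(weight_pos (p y)).ne'] using this
  have := h.antitone_p hy0 le_rfl hy1.le fun z hz =>
    hκ ▸ h.κ_anti ⟨hy0, hy.2⟩ ⟨hy0.trans_le hz.1, hz.2.le⟩ hz.1
  rw [h.half] at this
  exact absurd this (not_le.2 hneg)

lemma hasDerivAt_primitive01 {g : ℝ → ℝ} {x : ℝ} (hg : Integrable g vol01)
    (hx : x ∈ Ioo (0 : ℝ) 1) (hc : ContinuousAt g x) : HasDerivAt (primitive01 g) (g x) x := by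
  have hgi := integrable_indicator01 hg
  have he : (Ioo 0 1).indicator g =ᶠ[𝓝 x] g := by
    filter_upwards [isOpen_Ioo.mem_nhds hx] with y hy using indicator_of_mem hy g
  have := intervalIntegral.integral_hasDerivAt_right (a := 0) hgi.intervalIntegrable
    (hgi.aestronglyMeasurable.stronglyMeasurableAtFilter (l := 𝓝 x)) (hc.congr he.symm)
  rwa [indicator_of_mem hx] at this

namespace IsMinimiser

variable {ψ u : ℝ → ℝ}

lemma slopeRep_reflect (hu : IsMinimiser ψ u) {x : ℝ} (hx : x ∈ Ioo (0 : ℝ) 1) :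
    slopeRep u (1 - x) = -slopeRep u x := by
  have hx' : 1 - x ∈ Ioo (0 : ℝ) 1 := ⟨by linarith [hx.2], by linarith [hx.1]⟩
  have h1 := (hu.1.1.hasDerivAt hx').comp x ((hasDerivAt_id' x).const_sub 1)
  have h2 : HasDerivAt u (slopeRep u (1 - x) * -1) x := by
    refine h1.congr_of_eventuallyEq ?_
    filter_upwards [isOpen_Ioo.mem_nhds hx] with y hy using (hu.1.2 y hy).1
  linarith [h2.unique (hu.1.1.hasDerivAt hx)]

lemma weakDeriv_weakDeriv_reflect (hu : IsMinimiser ψ u) :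
    ∀ᵐ x ∂vol01, weakDeriv (weakDeriv u) (1 - x) = weakDeriv (weakDeriv u) x := by
  filter_upwards [hu.1.1.ae_hasDerivAt_slopeRep, ae_reflect hu.1.1.ae_hasDerivAt_slopeRep,
    ae_mem_Ioo] with x h1 h2 hx
  have h3 := h2.comp x ((hasDerivAt_id' x).const_sub 1)
  have h4 : HasDerivAt (fun y => -slopeRep u y) (weakDeriv (weakDeriv u) (1 - x) * -1) x := by
    refine h3.congr_of_eventuallyEq ?_
    filter_upwards [isOpen_Ioo.mem_nhds hx] with y hy using (hu.slopeRep_reflect hy).symm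
  linarith [h4.unique h1.neg]

end IsMinimiser

/-! ### The convex multiplier -/

/-- The derivative of the energy density with respect to the slope, up to sign. -/
noncomputable def slopeForce (u : ℝ → ℝ) (x : ℝ) : ℝ :=
  5 * weakDeriv (weakDeriv u) x ^ 2 * (slopeRep u x * quartRoot (slopeRep u x) ^ 14)

/-- The multiplier: its second distributional derivative is the contact force. -/
noncomputable def multiplier (u : ℝ → ℝ) (x : ℝ) : ℝ :=
  2 * weakDeriv (weakDeriv u) x * quartRoot (slopeRep u x) ^ 10 + primitive01 (slopeForce u) x

namespace MemH20

variable {u : ℝ → ℝ}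

lemma integrable_slopeForce (hu : MemH20 u) : Integrable (slopeForce u) vol01 := by
  refine (hu.memH2.memLp₂.integrable_sq.const_mul 5).mono' ?_ (Eventually.of_forall fun x => ?_)
  · have hp := hu.continuous_slopeRep
    exact ((hu.memH2.memLp₂.1.pow 2).const_mul 5).mul
      (hp.mul ((continuous_quartRoot.comp hp).pow 14)).aestronglyMeasurable
  · rw [Real.norm_eq_abs, slopeForce, abs_mul, abs_of_nonneg (by positivity :
      (0 : ℝ) ≤ 5 * weakDeriv (weakDeriv u) x ^ 2)]
    exact mul_le_of_le_one_right (by positivity) (abs_mul_quartRoot_pow_le _)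

lemma integrable_weakDeriv_mul (hu : MemH20 u) :
    Integrable (fun x => 2 * weakDeriv (weakDeriv u) x * quartRoot (slopeRep u x) ^ 10) vol01 := by
  refine (hu.integrable_weakDeriv_weakDeriv.const_mul 2).mul_bdd (c := 1)
    ((continuous_quartRoot.comp hu.continuous_slopeRep).pow 10).aestronglyMeasurable
    (Eventually.of_forall fun x => ?_)
  have := quartRoot_pos (slopeRep u x)
  rw [Real.norm_of_nonneg (by positivity)]
  exact pow_le_one₀ this.le (quartRoot_le_one _)

lemma integrable_multiplier (hu : MemH20 u) : Integrable (multiplier u) vol01 :=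
  hu.integrable_weakDeriv_mul.add
    ((continuous_primitive01 hu.integrable_slopeForce).integrableOn_Icc.mono_set Ioo_subset_Icc_self)

end MemH20

namespace IsMinimiser

variable {ψ u : ℝ → ℝ}

lemma slopeForce_reflect (hu : IsMinimiser ψ u) :
    ∀ᵐ x ∂vol01, slopeForce u (1 - x) = -slopeForce u x := by
  filter_upwards [hu.weakDeriv_weakDeriv_reflect, ae_mem_Ioo] with x h1 hx
  have hq : ∀ t, quartRoot (-t) = quartRoot t := fun t => by simp [quartRoot]
  rw [slopeForce, slopeForce, h1, hu.slopeRep_reflect hx, hq]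
  ring

lemma primitive01_slopeForce_reflect (hu : IsMinimiser ψ u) (x : ℝ) :
    primitive01 (slopeForce u) (1 - x) = primitive01 (slopeForce u) x := by
  set b := (Ioo (0 : ℝ) 1).indicator (slopeForce u) with hb
  have hbi : Integrable b := integrable_indicator01 hu.1.1.integrable_slopeForce
  have hodd : ∀ᵐ t, b (1 - t) = -b t := by
    have := hu.slopeForce_reflect
    rw [vol01, ae_restrict_iff' measurableSet_Ioo] at this
    filter_upwards [this] with t ht
    by_cases hm : t ∈ Ioo (0 : ℝ) 1
    · have hm' : 1 - t ∈ Ioo (0 : ℝ) 1 := ⟨by linarith [hm.2], by linarith [hm.1]⟩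
      rw [hb, indicator_of_mem hm, indicator_of_mem hm', ht hm]
    · have hm' : 1 - t ∉ Ioo (0 : ℝ) 1 := fun h => hm ⟨by linarith [h.2], by linarith [h.1]⟩
      rw [hb, indicator_of_notMem hm, indicator_of_notMem hm', neg_zero]
  have h1 : ∫ t in (1 - x)..x, b (1 - t) = ∫ t in (1 - x)..x, b t := by
    rw [intervalIntegral.integral_comp_sub_left, sub_sub_cancel]
  rw [intervalIntegral.integral_congr_ae (hodd.mono fun t ht _ => ht),
    intervalIntegral.integral_neg] at h1
  have h2 := intervalIntegral.integral_add_adjacent_intervals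
    (hbi.intervalIntegrable (a := 0) (b := 1 - x)) (hbi.intervalIntegrable (b := x))
  change ∫ t in (0 : ℝ)..(1 - x), b t = ∫ t in (0 : ℝ)..x, b t
  linarith

lemma multiplier_reflect (hu : IsMinimiser ψ u) :
    ∀ᵐ x ∂vol01, multiplier u (1 - x) = multiplier u x := by
  filter_upwards [hu.weakDeriv_weakDeriv_reflect, ae_mem_Ioo] with x h1 hx
  have hq : ∀ t, quartRoot (-t) = quartRoot t := fun t => by simp [quartRoot]
  rw [multiplier, multiplier, h1, hu.slopeRep_reflect hx, hq, hu.primitive01_slopeForce_reflect]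

/-- Integrating the slope term by parts puts both terms of the first variation against φ''. -/
lemma multiplier_nonneg_of_symm (hu : IsMinimiser ψ u) {φ : ℝ → ℝ} (hφ : IsTestFunction φ)
    (hsymm : ∀ x, φ (1 - x) = φ x) (hnn : ∀ x, 0 ≤ φ x) :
    0 ≤ ∫ x, multiplier u x * deriv (deriv φ) x ∂vol01 := by
  have h := hu.variation_nonneg hφ hsymm hnn
  have hF := hu.1.1.integrable_slopeForce
  have hA := hu.1.1.integrable_weakDeriv_mul
  have loc : ∀ {f : ℝ → ℝ}, Integrable f vol01 → LocallyIntegrableOn f (Ioo 0 1) := fun hf =>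
    IntegrableOn.locallyIntegrableOn hf
  have hP : Integrable (primitive01 (slopeForce u)) vol01 :=
    (continuous_primitive01 hF).integrableOn_Icc.mono_set Ioo_subset_Icc_self
  have hint := integral_primitive01_mul_deriv hF hφ.deriv
  have e1 : ∫ x, multiplier u x * deriv (deriv φ) x ∂vol01 =
      (∫ x, 2 * weakDeriv (weakDeriv u) x * quartRoot (slopeRep u x) ^ 10 *
        deriv (deriv φ) x ∂vol01) - ∫ x, slopeForce u x * deriv φ x ∂vol01 := by
    simp_rw [multiplier, add_mul]
    rw [integral_add (hφ.deriv.deriv.integrable_mul (loc hA))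
      (hφ.deriv.deriv.integrable_mul (loc hP)), hint, sub_eq_add_neg]
  rw [e1, ← integral_sub (hφ.deriv.deriv.integrable_mul (loc hA))
    (hφ.deriv.integrable_mul (loc hF))]
  refine h.trans_eq (integral_congr_ae ?_)
  filter_upwards [hu.1.1.weakDeriv_ae_eq] with x hx
  rw [hx, slopeForce]
  ring

/-- Since the multiplier is symmetric, φ and its reflection contribute equally, so testing with
their sum removes the symmetry restriction. -/
lemma multiplier_nonneg (hu : IsMinimiser ψ u) {φ : ℝ → ℝ} (hφ : IsTestFunction φ)
    (hnn : ∀ x, 0 ≤ φ x) : 0 ≤ ∫ x, multiplier u x * deriv (deriv φ) x ∂vol01 := by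
  have hΦ := hφ.add_const_mul hφ.reflect 1
  have h := hu.multiplier_nonneg_of_symm hΦ (fun x => by rw [sub_sub_cancel]; ring)
    fun x => by have := hnn x; have := hnn (1 - x); linarith
  have e : deriv (deriv fun x => φ x + 1 * φ (1 - x)) =
      fun x => deriv (deriv φ) x + deriv (deriv φ) (1 - x) := by
    rw [hφ.deriv_add_const_mul hφ.reflect, hφ.deriv.deriv_add_const_mul hφ.reflect.deriv,
      hφ.deriv_reflect]
    funext x
    rw [deriv.fun_neg, hφ.deriv.deriv_reflect, neg_neg, one_mul]
  have hi := hφ.deriv.deriv.integrable_mul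
    (IntegrableOn.locallyIntegrableOn hu.1.1.integrable_multiplier)
  have hr : (fun x => multiplier u x * deriv (deriv φ) (1 - x)) =ᵐ[vol01]
      fun x => (fun y => multiplier u y * deriv (deriv φ) y) (1 - x) := by
    filter_upwards [hu.multiplier_reflect] with x hx
    rw [hx]
  have hi' : Integrable (fun x => multiplier u x * deriv (deriv φ) (1 - x)) vol01 :=
    (measurePreserving_reflect.integrable_comp_of_integrable hi).congr hr.symm
  rw [e] at h
  simp_rw [mul_add] at h
  rw [integral_add hi hi', integral_congr_ae hr,
    integral_reflect fun y => multiplier u y * deriv (deriv φ) y] at h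
  linarith

/-! ### From minimisers to the height bound -/

/-- A minimiser solves the Euler–Lagrange system. -/
lemma exists_elasticaSystem (hu : IsMinimiser ψ u) :
    ∃ κ ν, ElasticaSystem (slopeRep u) κ ν := by
  obtain ⟨C, hC, hCae⟩ := exists_convexOn_ae_eq hu.1.1.integrable_multiplier
    fun φ hφ hnn => hu.multiplier_nonneg hφ hnn
  have hCc : ContinuousOn C (Ioo 0 1) := hC.continuousOn isOpen_Ioo
  have hmaps : MapsTo (fun x : ℝ => 1 - x) (Ioo 0 1) (Ioo 0 1) := fun x hx =>
    ⟨by linarith [hx.2], by linarith [hx.1]⟩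
  have hCsymm : EqOn (fun x => C (1 - x)) C (Ioo 0 1) := by
    refine Measure.eqOn_open_of_ae_eq (μ := volume) ?_ isOpen_Ioo
      (hCc.comp (continuous_const.sub continuous_id).continuousOn hmaps) hCc
    change _ =ᵐ[vol01] _
    filter_upwards [hCae, ae_reflect hCae, hu.multiplier_reflect] with x h1 h2 h3
    rw [← h1, ← h2, h3]
  set p := slopeRep u with hp
  have hpc : Continuous p := hu.1.1.continuous_slopeRep
  set B := primitive01 (slopeForce u) with hB
  have hBc : Continuous B := continuous_primitive01 hu.1.1.integrable_slopeForce
  have hqc : Continuous fun x => quartRoot (p x) := continuous_quartRoot.comp hpc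
  have hq0 : ∀ x, quartRoot (p x) ≠ 0 := fun x => (quartRoot_pos _).ne'
  -- Solving the definition of the multiplier for u'', with C in place of the multiplier, gives a
  -- continuous representative g on (0,1).
  set g : ℝ → ℝ := fun x => (C x - B x) / 2 / quartRoot (p x) ^ 10 with hg
  have hgc : ContinuousOn g (Ioo 0 1) :=
    ((hCc.sub hBc.continuousOn).div_const 2).div (hqc.pow 10).continuousOn
      fun x _ => pow_ne_zero 10 (hq0 x)
  have hgae : weakDeriv (weakDeriv u) =ᵐ[vol01] g := by
    filter_upwards [hCae] with x hx
    have := hq0 x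
    rw [hg]
    simp only
    rw [← hx, multiplier, add_sub_cancel_right, ← hp]
    field_simp
  have hgi : Integrable g vol01 := hu.1.1.integrable_weakDeriv_weakDeriv.congr hgae
  have hpg : p = primitive01 g := primitive01_congr hgae
  have hdp : ∀ x ∈ Ioo (0 : ℝ) 1, HasDerivAt p (g x) x := fun x hx => by
    rw [hpg]
    exact hasDerivAt_primitive01 hgi hx (hgc.continuousAt (isOpen_Ioo.mem_nhds hx))
  set b : ℝ → ℝ := fun x => 5 * g x ^ 2 * (p x * quartRoot (p x) ^ 14) with hb
  have hbae : slopeForce u =ᵐ[vol01] b := by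
    filter_upwards [hgae] with x hx
    rw [slopeForce, hx]
  have hbc : ContinuousOn b (Ioo 0 1) :=
    (continuousOn_const.mul (hgc.pow 2)).mul (hpc.mul (hqc.pow 14)).continuousOn
  have hdB : ∀ x ∈ Ioo (0 : ℝ) 1, HasDerivAt B (b x) x := fun x hx => by
    rw [hB, primitive01_congr hbae]
    exact hasDerivAt_primitive01 (hu.1.1.integrable_slopeForce.congr hbae) hx
      (hbc.continuousAt (isOpen_Ioo.mem_nhds hx))
  have hint : interior (Ioo (0 : ℝ) 1) = Ioo 0 1 := isOpen_Ioo.interior_eq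
  refine ⟨fun x => (C x - B x) / 2 / quartRoot (p x) ^ 5,
    fun x => -derivWithin C (Ioi x) x / 2, ?_⟩
  refine ⟨hpc, by simp [hp, slopeRep, primitive01], ?_, fun x hx => ?_, ?_, fun x hx => ?_,
    fun x hx => ?_, fun x hx y hy hxy => ?_⟩
  · have := hu.slopeRep_reflect (x := 1 / 2) ⟨by norm_num, by norm_num⟩
    norm_num at this
    norm_num
    linarith
  · refine (hdp x hx).congr_deriv ?_
    have := hq0 x
    rw [hg, weight_eq_quartRoot_pow]
    field_simp
  · exact ((hCc.sub hBc.continuousOn).div_const 2).div (hqc.pow 5).continuousOn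
      fun x _ => pow_ne_zero 5 (hq0 x)
  · have hdC : HasDerivWithinAt C (derivWithin C (Ioi x) x) (Ici x) x :=
      (hC.hasDerivWithinAt_rightDeriv_of_mem_interior (by rwa [hint])).Ici_of_Ioi
    have hdq : HasDerivWithinAt (fun x => quartRoot (p x) ^ 5)
        (5 * quartRoot (p x) ^ 4 * (-(p x * weight (p x)) / 2 * g x)) (Ici x) x := by
      have := (((hasDerivAt_quartRoot (p x)).comp x (hdp x hx)).pow 5).hasDerivWithinAt (s := Ici x)
      exact this.congr_deriv (by push_cast; rfl)
    -- The term from B' = b cancels the derivative of the denominator q(p)⁵, and only C'₊/(2q(p)⁵)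
    -- remains.
    refine (((hdC.sub (hdB x hx).hasDerivWithinAt).div_const 2).div hdq
      (pow_ne_zero 5 (hq0 x))).congr_deriv ?_
    have hCB : (C x - B x) / 2 = g x * quartRoot (p x) ^ 10 := by
      have := hq0 x
      rw [hg]; field_simp
    have hne := hq0 x
    simp only [Pi.sub_apply, hb]
    rw [hCB, weight_eq_quartRoot_pow]
    generalize quartRoot (p x) = q at *
    field_simp
    ring
  · have hx1 : x ∈ Ioo (0 : ℝ) 1 := ⟨hx.1, by linarith [hx.2]⟩
    -- By symmetry the chord of C from x to 1 - x is horizontal, so convexity makes the right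
    -- derivative at x nonpositive.
    have h1 := hC.rightDeriv_le_slope_of_mem_interior (x := x) (y := 1 - x) (by rwa [hint])
      (hmaps hx1) (by linarith [hx.2])
    have h2 : C (1 - x) = C x := hCsymm hx1
    rw [slope_def_field, h2, sub_self, zero_div] at h1
    linarith
  · have := hC.monotoneOn_rightDeriv (a := x) (b := y)
      (by rw [hint]; exact ⟨hx.1, by linarith [hx.2]⟩)
      (by rw [hint]; exact ⟨hy.1, by linarith [hy.2]⟩) hxy
    simp only at this ⊢
    linarith

/-- The slope is nonnegative on the left half, so u is largest at 1/2; symmetry covers the right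
half. -/
lemma le_half (hu : IsMinimiser ψ u) {m : ℝ} (hm : 0 < m) (hgap : slopeGap m = 0) {x : ℝ}
    (hx : x ∈ Ioo (0 : ℝ) 1) : u x ≤ m / 2 := by
  obtain ⟨κ, ν, h⟩ := hu.exists_elasticaSystem
  have key : ∀ y ∈ Ioc (0 : ℝ) (1 / 2), u y ≤ m / 2 := by
    intro y hy
    rw [hu.1.1.eq_integral ⟨hy.1.le, by linarith [hy.2]⟩]
    refine le_trans ?_ (h.integral_le hm hgap)
    have h0 : 0 ≤ ∫ t in y..(1 / 2), slopeRep u t :=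
      intervalIntegral.integral_nonneg hy.2 fun t ht => h.nonneg_p ⟨hy.1.le.trans ht.1, ht.2⟩
    rw [← intervalIntegral.integral_add_adjacent_intervals
      (h.cont.intervalIntegrable 0 y) (h.cont.intervalIntegrable y (1 / 2))]
    linarith
  rcases le_total x (1 / 2) with h1 | h1
  · exact key x ⟨hx.1, h1⟩
  · rw [(hu.1.2 x hx).1]
    exact key (1 - x) ⟨by linarith [hx.2], by linarith⟩

end IsMinimiser

end WillmoreObstacle

open WillmoreObstacle
theorem theorem1p2 :
    ∃ m : ℝ, IsGreatest (Set.range slopeBound) m ∧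
      |m / 2 - 1.189046454| < 5 / 10 ^ 10 ∧
      (∀ ψ : ℝ → ℝ, IsObstacle ψ → (∃ u : ℝ → ℝ, IsMinimiser ψ u) →
        ∀ x ∈ Set.Icc (0 : ℝ) 1, ψ x ≤ m / 2) ∧
      (∀ ψ : ℝ → ℝ, IsObstacle ψ → (∃ x ∈ Set.Icc (0 : ℝ) 1, m / 2 < ψ x) →
        ¬ ∃ u : ℝ → ℝ, IsMinimiser ψ u) := by
  obtain ⟨m, hm1, hm2, hgap⟩ := exists_slopeGap_eq_zero
  have hm0 : 0 < m := by linarith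
  have hmain : ∀ ψ : ℝ → ℝ, IsObstacle ψ → (∃ u : ℝ → ℝ, IsMinimiser ψ u) →
      ∀ x ∈ Set.Icc (0 : ℝ) 1, ψ x ≤ m / 2 := by
    rintro ψ hψ ⟨u, hu⟩ x hx
    obtain ⟨σ, hσ, hneg⟩ := hψ.neg
    -- At the end points ψ is negative by (A); u ≥ ψ is only required in the interior.
    rcases eq_or_lt_of_le hx.1 with h0 | h0
    · linarith [hneg x hx (Or.inl (by linarith))]
    rcases eq_or_lt_of_le hx.2 with h1 | h1
    · linarith [hneg x hx (Or.inr (by linarith))]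
    exact ((hu.1.2 x ⟨h0, h1⟩).2).trans (hu.le_half hm0 hgap ⟨h0, h1⟩)
  refine ⟨m, isGreatest_slopeBound hm0.le hgap, ?_, hmain, ?_⟩
  · rw [abs_lt]
    constructor <;> norm_num at hm1 hm2 ⊢ <;> linarith
  · rintro ψ hψ ⟨x, hx, hlt⟩ hex
    exact absurd (hmain ψ hψ hex x hx) (not_le.2 hlt)
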